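/- For a partition $\lambda$, let $\mathrm{rank}(\lambda)$ be its largest part minus its number of parts. Let $o(\lambda)$ be the number of ones in $\lambda$ and $\mu(\lambda)$ the number of parts of $\lambda$ that are strictly larger than $o(\lambda)$; let $\mathrm{crank}(\lambda)$ be the largest part of $\lambda$ if $o(\lambda)=0$, and $\mu(\lambda)-o(\lambda)$ if $o(\lambda)>0$. For $m\in\mathbb Z$ let $N(m,N)$ and $M(m,N)$ denote the number of partitions of $N$ with rank $m$ and with crank $m$, respectively, with the usual convention that for $N=1$ one sets instead $M(1,1)=M(-1,1)=1$, $M(0,1)=-1$ and $M(m,1)=0$ otherwise. Define $$\mathrm{ospt}(N):=\sum_{m\ge 1} m\,M(m,N)-\sum_{m\ge 1} m\,N(m,N).$$ Theorem. Let $N\ge 1$ be an integer. Then $\mathrm{ospt}(N)$ is odd if and only if $24N-1=\ell^{4a+1}m^2$ for some prime $\ell\equiv 23\pmod{24}$ and some integers $a\ge 0$ and $m\ge 1$ with $\gcd(\ell,m)=1$. -/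

import Mathlib

namespace Ospt

/-- The largest part of a partition (`0` for the empty partition of `0`). -/
def largestPart {N : ℕ} (p : Nat.Partition N) : ℕ := p.parts.sup

/-- Dyson's rank: largest part minus number of parts. -/
def rank {N : ℕ} (p : Nat.Partition N) : ℤ := (largestPart p : ℤ) - (p.parts.card : ℤ)

/-- `o(p)`: the number of ones in `p`. -/
def numOnes {N : ℕ} (p : Nat.Partition N) : ℕ := p.parts.count 1

/-- `μ(p)`: the number of parts (with multiplicity) strictly larger than the number of ones. -/
def numLarge {N : ℕ} (p : Nat.Partition N) : ℕ := p.parts.countP (fun i => numOnes p < i)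

/-- The Andrews-Garvan crank. -/
def crank {N : ℕ} (p : Nat.Partition N) : ℤ :=
  if numOnes p = 0 then (largestPart p : ℤ) else (numLarge p : ℤ) - (numOnes p : ℤ)

/-- `N(m, N)`: the number of partitions of `N` with rank `m`. -/
def rankCount (m : ℤ) (N : ℕ) : ℤ :=
  ((Finset.univ.filter (fun p : Nat.Partition N => rank p = m)).card : ℤ)

/-- `M(m, N)`: the number of partitions of `N` with crank `m`. For `N = 1` the universal convention
is that the values are the coefficients of `q` in the two-variable crank generating function,
namely `w - 1 + w⁻¹`. -/
def crankCount (m : ℤ) (N : ℕ) : ℤ :=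
  if N = 1 then
    (if m = 1 ∨ m = -1 then 1 else if m = 0 then -1 else 0)
  else ((Finset.univ.filter (fun p : Nat.Partition N => crank p = m)).card : ℤ)

theorem largestPart_le {N : ℕ} (p : Nat.Partition N) : largestPart p ≤ N :=
  Multiset.sup_le.2 (fun _ hb => Nat.Partition.le_of_mem_parts hb)

theorem rank_le {N : ℕ} (p : Nat.Partition N) : rank p ≤ N := by
  have := largestPart_le p
  unfold rank
  omega

theorem crank_le {N : ℕ} (p : Nat.Partition N) : crank p ≤ N := by
  have h1 := largestPart_le p
  have h2 : numLarge p ≤ p.parts.card := Multiset.countP_le_card _ _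
  have h3 : p.parts.card ≤ N := by
    have := Multiset.card_nsmul_le_sum (s := p.parts) (a := 1) (fun x hx => p.parts_pos hx)
    simpa [p.parts_sum] using this
  unfold crank
  split <;> omega

/-- No partition of `N` has rank larger than `N`. -/
theorem rankCount_eq_zero {m : ℤ} {N : ℕ} (h : (N : ℤ) < m) : rankCount m N = 0 := by
  unfold rankCount
  rw [Finset.filter_eq_empty_iff.2]
  · simp
  · intro p _ hp
    have := rank_le p
    omega

/-- `M(m, N)` vanishes for `m > N`. -/
theorem crankCount_eq_zero {m : ℤ} {N : ℕ} (h : (N : ℤ) < m) : crankCount m N = 0 := by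
  unfold crankCount
  split
  · rw [if_neg (by omega), if_neg (by omega)]
  · rw [Finset.filter_eq_empty_iff.2]
    · simp
    · intro p _ hp
      have := crank_le p
      omega

/-- The `r`-th positive crank moment `∑_{m ≥ 1} m ^ r * M(m, N)`; the terms with `m > N` vanish by
`crankCount_eq_zero`. -/
def posCrankMoment (r N : ℕ) : ℤ := ∑ m ∈ Finset.Icc 1 N, (m : ℤ) ^ r * crankCount (m : ℤ) N

/-- The `r`-th positive rank moment `∑_{m ≥ 1} m ^ r * N(m, N)`; the terms with `m > N` vanish by
`rankCount_eq_zero`. -/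
def posRankMoment (r N : ℕ) : ℤ := ∑ m ∈ Finset.Icc 1 N, (m : ℤ) ^ r * rankCount (m : ℤ) N

/-- The ospt-function: first positive crank moment minus first positive rank moment. -/
def ospt (N : ℕ) : ℤ := posCrankMoment 1 N - posRankMoment 1 N

end Ospt

namespace Ospt

open Finset

/-! Modulo two, `ospt N` is the number of factorizations `24 * N - 1 = d * e` with `d < e`
(`ospt_eq_smallDivisorCount`). Since `24 * N - 1` is not a square, this is half its number of
divisors, whose parity is read off from the prime exponents (`odd_smallDivisorCount_iff`).

The congruence is proved after multiplying both generating functions by the Euler product, which is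
a unit. On the partition side, `ospt N` is the sum over `r ≥ 1` of the number of partitions with
crank at least `r` minus the number with rank at least `r`. Dyson's adjoint yields the recurrence
`rankGE_add`; the crank numbers equal `holeCount`, which obeys the similar recurrence
`holeCount_add`. Times the Euler product, these recurrences are solved modulo two by partial theta
series. Summed over `r`, the coefficient at `N` counts the factorizations `2 * N = a * b` with `a +
b` odd, where `a < b` for the crank and `3 * a < b` for the rank.

On the divisor side, the Euler product is modulo two the sum of `q ^ ((x ^ 2 - 1) / 24)` over
positive `x` prime to 6, so the coefficient at `M` counts solutions of `x ^ 2 + d * e = 24 * M`. The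
two coefficients are compared in `card_triples`. Apart from an even number of degenerate solutions,
a linear substitution leads to `3 * z ^ 2 + g * e = 2 * M`, with `e` prime to 6 and one solution for
each admissible class of `z` modulo `2 * g`. The involution `z ↦ -z` fixes only the classes of `0`
and `g`, and these are again factorizations `2 * M = g * m`, now with `m` not divisible by 3. This
last restriction is removed by `card_oppositeFactors_combination`. -/

/-! ### Parity of cardinalities -/

/-- A finite set with an involution has as many elements, modulo two, as the involution has fixed
points. -/
theorem card_eq_card_fixed {α : Type*} [DecidableEq α] (s : Finset α) (f : α → α)
    (hf : ∀ a ∈ s, f a ∈ s) (hff : ∀ a ∈ s, f (f a) = a) :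
    (#s : ZMod 2) = #{a ∈ s | f a = a} := by
  have h : ∑ a ∈ s with ¬ f a = a, (1 : ZMod 2) = 0 := by
    refine sum_involution (fun a _ => f a) (fun a ha => by decide) ?_ ?_ ?_
    · intro a ha _
      exact (mem_filter.1 ha).2
    · intro a ha
      rw [mem_filter] at ha ⊢
      refine ⟨hf a ha.1, ?_⟩
      rw [hff a ha.1]
      exact fun h => ha.2 h.symm
    · intro a ha
      exact hff a (mem_filter.1 ha).1
  rw [← card_filter_add_card_filter_not (s := s) (fun a => f a = a), Nat.cast_add,
    card_eq_sum_ones {a ∈ s | ¬ f a = a}]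
  push_cast
  rw [h, add_zero]

/-- A finite set with a fixed-point free involution has an even number of elements. -/
theorem card_eq_zero_of_involution {α : Type*} [DecidableEq α] (s : Finset α) (f : α → α)
    (hf : ∀ a ∈ s, f a ∈ s) (hff : ∀ a ∈ s, f (f a) = a) (hne : ∀ a ∈ s, f a ≠ a) :
    (#s : ZMod 2) = 0 := by
  rw [card_eq_card_fixed s f hf hff, filter_eq_empty_iff.2 hne]
  simp

/-! ### The number of divisors below the square root -/

/-- The number of factorizations `n = d * e` with `d < e`. -/
def smallDivisorCount (n : ℕ) : ℕ := #{x ∈ n.divisorsAntidiagonal | x.1 < x.2}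

theorem card_divisors_eq_two_mul {n : ℕ} (h : ¬ IsSquare n) :
    #n.divisors = 2 * smallDivisorCount n := by
  have hswap : #{x ∈ n.divisorsAntidiagonal | ¬ x.1 < x.2} = smallDivisorCount n := by
    refine card_bij' (fun x _ => x.swap) (fun x _ => x.swap) ?_ ?_ (fun _ _ => rfl) (fun _ _ => rfl)
    · rintro ⟨a, b⟩ hx
      simp only [mem_filter, Nat.mem_divisorsAntidiagonal, Prod.swap] at hx ⊢
      refine ⟨⟨by rw [mul_comm]; exact hx.1.1, hx.1.2⟩, ?_⟩
      refine lt_of_le_of_ne (not_lt.1 hx.2) ?_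
      rintro rfl
      exact h ⟨b, hx.1.1.symm⟩
    · rintro ⟨a, b⟩ hx
      simp only [mem_filter, Nat.mem_divisorsAntidiagonal, Prod.swap] at hx ⊢
      exact ⟨⟨by rw [mul_comm]; exact hx.1.1, hx.1.2⟩, hx.2.le.not_gt⟩
  rw [show #n.divisors = #n.divisorsAntidiagonal by rw [← Nat.map_div_right_divisors, card_map],
    ← card_filter_add_card_filter_not (s := n.divisorsAntidiagonal) (fun x => x.1 < x.2), hswap,
    smallDivisorCount]
  omega

/-! ### Parity of the number of divisors and the prime exponents -/

theorem odd_card_divisors_iff {n : ℕ} (hn : n ≠ 0) : Odd #n.divisors ↔ IsSquare n := by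
  constructor
  · intro h
    by_contra hs
    rw [card_divisors_eq_two_mul hs] at h
    exact Nat.not_odd_iff_even.2 (even_two_mul _) h
  · rintro ⟨m, rfl⟩
    have hm : m ≠ 0 := by rintro rfl; exact hn rfl
    rw [Nat.card_divisors hn]
    refine Finset.prod_induction _ Odd (fun a b => Odd.mul) odd_one ?_
    intro p _
    rw [Nat.factorization_mul hm hm]
    exact ⟨m.factorization p, by simp; ring⟩

theorem isSquare_of_forall_even_factorization {n : ℕ} (hn : n ≠ 0)
    (h : ∀ p, p.Prime → Even (n.factorization p)) : IsSquare n := by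
  rw [← odd_card_divisors_iff hn, Nat.card_divisors hn]
  refine Finset.prod_induction _ Odd (fun a b => Odd.mul) odd_one ?_
  intro p hp
  exact (h p (Nat.prime_of_mem_primeFactors hp)).add_one

theorem sq_mod_of_coprime {m : ℕ} (h2 : ¬ 2 ∣ m) (h3 : ¬ 3 ∣ m) : m ^ 2 % 24 = 1 := by
  have : m % 24 < 24 := Nat.mod_lt _ (by norm_num)
  rw [Nat.pow_mod]
  have h2' : ¬ 2 ∣ m % 24 := by omega
  have h3' : ¬ 3 ∣ m % 24 := by omega
  generalize m % 24 = r at *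
  interval_cases r <;> simp_all

theorem not_isSquare_of_mod {n : ℕ} (hn : n % 24 = 23) : ¬ IsSquare n := by
  rintro ⟨m, rfl⟩
  have := Nat.mul_mod m m 4
  have h4 : m % 4 < 4 := Nat.mod_lt _ (by norm_num)
  have : m * m % 4 = 3 := by omega
  rw [Nat.mul_mod] at this
  generalize m % 4 = r at *
  interval_cases r <;> simp_all

/-- For `n ≡ -1` modulo `24`, the number of divisors of `n` is twice an odd number exactly if `n` is
a square times `ℓ ^ (4 * a + 1)` for a prime `ℓ`, which is then `≡ -1` modulo `24`. -/
theorem odd_smallDivisorCount_iff {n : ℕ} (hn : n % 24 = 23) :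
    Odd (smallDivisorCount n) ↔
      ∃ ℓ a m : ℕ, ℓ.Prime ∧ ℓ ≡ 23 [MOD 24] ∧ 0 < m ∧ Nat.Coprime ℓ m ∧
        n = ℓ ^ (4 * a + 1) * m ^ 2 := by
  have hn0 : n ≠ 0 := by rintro rfl; simp at hn
  have hsq := not_isSquare_of_mod hn
  have hcard := card_divisors_eq_two_mul hsq
  constructor
  · intro hodd
    obtain ⟨ℓ, hℓ, hv⟩ : ∃ p, p.Prime ∧ ¬ Even (n.factorization p) := by
      by_contra! h
      exact hsq (isSquare_of_forall_even_factorization hn0 h)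
    rw [Nat.not_even_iff_odd] at hv
    have hfac := Nat.ordProj_mul_ordCompl_eq_self n ℓ
    have hcop : Nat.Coprime ℓ (n / ℓ ^ n.factorization ℓ) := Nat.coprime_ordCompl hℓ hn0
    set v := n.factorization ℓ
    set k := n / ℓ ^ v
    have hk0 : k ≠ 0 := by
      intro h
      rw [h, mul_zero] at hfac
      exact hn0 hfac.symm
    rw [← hfac, (Nat.Coprime.pow_left v hcop).card_divisors_mul, Nat.divisors_prime_pow hℓ,
      card_map, card_range, hfac] at hcard
    obtain ⟨u, hu⟩ := hv
    have hmul : (u + 1) * #k.divisors = smallDivisorCount n := by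
      rw [hu] at hcard
      linarith
    rw [← hmul, Nat.odd_mul, odd_card_divisors_iff hk0] at hodd
    obtain ⟨hu1, m, hm⟩ := hodd
    obtain ⟨a, ha⟩ : ∃ a, u = 2 * a := by
      obtain ⟨a, ha⟩ := hu1
      exact ⟨a, by omega⟩
    have hm0 : 0 < m := by
      rcases Nat.eq_zero_or_pos m with rfl | h
      · exact absurd hm hk0
      · exact h
    have hv4 : v = 4 * a + 1 := by omega
    rw [hm] at hcop
    have hn' : n = ℓ ^ (4 * a + 1) * m ^ 2 := by rw [← hfac, hv4, hm, sq]
    refine ⟨ℓ, a, m, hℓ, ?_, hm0, hcop.coprime_mul_right_right, hn'⟩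
    have hndvd : ∀ p, p ∣ 24 → p ≠ 1 → ¬ p ∣ n := by
      intro p hp hp1 hpn
      have h23 : n ≡ 23 [MOD p] := Nat.ModEq.of_dvd hp (show n % 24 = 23 % 24 from hn)
      have h1 : p ∣ 23 := (h23.dvd_iff (dvd_refl p)).1 hpn
      exact hp1 (Nat.dvd_one.1 ((Nat.dvd_gcd hp h1).trans (by norm_num)))
    have hℓn : ℓ ∣ n := by
      rw [hn', pow_succ]
      exact (dvd_mul_left _ _).mul_right _
    have hmn : m ∣ n := by
      rw [hn', sq]
      exact (dvd_mul_left _ _).mul_left _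
    -- Both `ℓ` and `m` divide `n`, which is prime to 6; so their squares are 1 modulo 24, and `n ≡
    -- ℓ` remains.
    have hℓ2 : ℓ ^ 2 % 24 = 1 := sq_mod_of_coprime
      (fun h => hndvd 2 (by norm_num) (by norm_num) (h.trans hℓn))
      (fun h => hndvd 3 (by norm_num) (by norm_num) (h.trans hℓn))
    have hm2 : m ^ 2 % 24 = 1 := sq_mod_of_coprime
      (fun h => hndvd 2 (by norm_num) (by norm_num) (h.trans hmn))
      (fun h => hndvd 3 (by norm_num) (by norm_num) (h.trans hmn))
    have e1 : (ℓ ^ 2) ^ (2 * a) * ℓ * m ^ 2 ≡ 1 ^ (2 * a) * ℓ * 1 [MOD 24] :=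
      Nat.ModEq.mul (Nat.ModEq.mul_right _ (Nat.ModEq.pow _ hℓ2)) hm2
    have e2 : (ℓ ^ 2) ^ (2 * a) * ℓ * m ^ 2 = n := by rw [hn']; ring
    rw [e2, one_pow, one_mul, mul_one] at e1
    exact e1.symm.trans hn
  · rintro ⟨ℓ, a, m, hℓ, -, hm, hcop, hn'⟩
    have hc : Nat.Coprime (ℓ ^ (4 * a + 1)) (m ^ 2) := Nat.Coprime.pow _ _ hcop
    have hm2 : Odd #(m ^ 2).divisors :=
      (odd_card_divisors_iff (by positivity)).2 ⟨m, sq m⟩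
    have h1 : #n.divisors = (4 * a + 2) * #(m ^ 2).divisors := by
      rw [hn', hc.card_divisors_mul, Nat.divisors_prime_pow hℓ, card_map, card_range]
    have h2 : smallDivisorCount n = (2 * a + 1) * #(m ^ 2).divisors := by linarith
    rw [h2]
    exact Odd.mul ⟨a, rfl⟩ hm2

/-! ### Factorizations into factors of opposite parity -/

/-- The ordered factorizations of `n` into two factors of opposite parity. -/
def oppositeFactors (n : ℕ) : Finset (ℕ × ℕ) := {x ∈ n.divisorsAntidiagonal | Odd (x.1 + x.2)}

theorem mem_oppositeFactors {n : ℕ} {x : ℕ × ℕ} :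
    x ∈ oppositeFactors n ↔ (x.1 * x.2 = n ∧ n ≠ 0) ∧ Odd (x.1 + x.2) := by
  simp [oppositeFactors]

/-- Each unordered pair of factors of opposite parity has one ordering with odd second entry and one
ordering that is increasing. -/
theorem card_oppositeFactors_odd_snd (n : ℕ) :
    #{x ∈ oppositeFactors n | Odd x.2} = #{x ∈ oppositeFactors n | x.1 < x.2} := by
  refine card_bij' (fun x _ => if x.1 < x.2 then x else x.swap)
    (fun x _ => if Odd x.2 then x else x.swap) ?_ ?_ ?_ ?_
  all_goals
    rintro ⟨a, b⟩ hx
    simp only [mem_filter, mem_oppositeFactors] at hx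
    obtain ⟨⟨⟨h1, h2⟩, h3⟩, h4⟩ := hx
    have hba : b * a = n := by rw [mul_comm, h1]
  · by_cases h : a < b
    · simp only [h, if_true, mem_filter, mem_oppositeFactors]
      exact ⟨⟨⟨h1, h2⟩, h3⟩, trivial⟩
    · have : b < a := by
        refine lt_of_le_of_ne (not_lt.1 h) ?_
        rintro rfl
        exact absurd h3 (by simp)
      simp only [h, if_false, mem_filter, mem_oppositeFactors, Prod.swap]
      exact ⟨⟨⟨hba, h2⟩, by rwa [add_comm]⟩, this⟩
  · by_cases h : Odd b
    · simp only [h, if_true, mem_filter, mem_oppositeFactors]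
      exact ⟨⟨⟨h1, h2⟩, h3⟩, trivial⟩
    · simp only [h, if_false, mem_filter, mem_oppositeFactors, Prod.swap]
      refine ⟨⟨⟨hba, h2⟩, by rwa [add_comm]⟩, ?_⟩
      rw [Nat.odd_iff] at *
      omega
  · have : ¬ Odd a := by
      rw [Nat.odd_iff] at *
      omega
    by_cases h : a < b <;> simp [h, h4, this]
  · have : ¬ b < a := h4.le.not_gt
    by_cases h : Odd b <;> simp only [h, if_true, if_false, h4, Prod.swap, this]

/-- Among the factorizations into factors of opposite parity whose second factor is a multiple of
three, those with odd second factor are as many as those whose second factor is more than thrice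
the first. -/
theorem card_oppositeFactors_three_dvd (n : ℕ) :
    #{x ∈ oppositeFactors n | Odd x.2 ∧ 3 ∣ x.2} =
      #{x ∈ oppositeFactors n | 3 * x.1 < x.2 ∧ 3 ∣ x.2} := by
  by_cases hn : 3 ∣ n
  · obtain ⟨k, rfl⟩ := hn
    -- Dividing the second factor by 3 keeps its parity and turns `3 * a < b` into `a < b / 3`, so
    -- the previous lemma applies to `k`.
    have key : ∀ (Q : ℕ × ℕ → Prop) [DecidablePred Q],
        #{x ∈ oppositeFactors (3 * k) | Q x ∧ 3 ∣ x.2} =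
          #{x ∈ oppositeFactors k | Q (x.1, 3 * x.2)} := by
      intro Q _
      symm
      refine card_bij (fun x _ => (x.1, 3 * x.2)) ?_ ?_ ?_
      · rintro ⟨a, b⟩ hx
        simp only [mem_filter, mem_oppositeFactors] at hx ⊢
        obtain ⟨⟨⟨rfl, h2⟩, h3⟩, h4⟩ := hx
        refine ⟨⟨⟨by ring, by omega⟩, ?_⟩, h4, Dvd.intro _ rfl⟩
        rw [Nat.odd_iff] at *
        omega
      · rintro ⟨a, b⟩ _ ⟨c, d⟩ _ h
        simpa using h
      · rintro ⟨a, b⟩ hx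
        simp only [mem_filter, mem_oppositeFactors] at hx
        obtain ⟨⟨⟨h1, h2⟩, h3⟩, h4, c, rfl⟩ := hx
        refine ⟨(a, c), ?_, rfl⟩
        simp only [mem_filter, mem_oppositeFactors]
        refine ⟨⟨⟨by linarith, by omega⟩, ?_⟩, h4⟩
        rw [Nat.odd_iff] at *
        omega
    rw [key (fun x => Odd x.2), key (fun x => 3 * x.1 < x.2)]
    have := card_oppositeFactors_odd_snd k
    have e : ∀ b : ℕ, Odd (3 * b) ↔ Odd b := by
      intro b
      rw [Nat.odd_iff, Nat.odd_iff]
      omega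
    simpa [e] using this
  · have hempty : ∀ Q : ℕ × ℕ → Prop, ∀ x ∈ oppositeFactors n, ¬ (Q x ∧ 3 ∣ x.2) := by
      rintro Q x hx ⟨-, h⟩
      rw [mem_oppositeFactors] at hx
      exact hn (hx.1.1 ▸ h.mul_left _)
    rw [filter_eq_empty_iff.2 (hempty fun x => Odd x.2),
      filter_eq_empty_iff.2 (hempty fun x => 3 * x.1 < x.2)]

/-- The pairs with `3 ∣ x.2` contribute equally to both conditions, so including them on both sides
changes the sum by an even number. -/
theorem card_oppositeFactors_combination (n : ℕ) :
    (#{x ∈ oppositeFactors n | Odd x.2 ∧ ¬ 3 ∣ x.2} : ZMod 2) +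
        #{x ∈ oppositeFactors n | 3 * x.1 < x.2 ∧ ¬ 3 ∣ x.2} =
      #{x ∈ oppositeFactors n | x.1 < x.2} + #{x ∈ oppositeFactors n | 3 * x.1 < x.2} := by
  have split : ∀ (Q : ℕ × ℕ → Prop) [DecidablePred Q],
      #{x ∈ oppositeFactors n | Q x} = #{x ∈ oppositeFactors n | Q x ∧ 3 ∣ x.2} +
        #{x ∈ oppositeFactors n | Q x ∧ ¬ 3 ∣ x.2} := by
    intro Q _
    rw [← card_filter_add_card_filter_not (s := {x ∈ oppositeFactors n | Q x}) (fun x => 3 ∣ x.2),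
      filter_filter, filter_filter]
  rw [← card_oppositeFactors_odd_snd, split (fun x => Odd x.2), split (fun x => 3 * x.1 < x.2),
    card_oppositeFactors_three_dvd]
  push_cast
  linear_combination -(CharTwo.add_self_eq_zero
    (#{x ∈ oppositeFactors n | 3 * x.1 < x.2 ∧ 3 ∣ x.2} : ZMod 2))

/-! ### The solutions of `x ^ 2 + d * e = 24 * M` -/

/-- The solutions of `x ^ 2 + d * e = 24 * M` with `0 < d < e` and `x` prime to `6`. -/
def triples (M : ℕ) : Finset (ℕ × ℕ × ℕ) :=
  {t ∈ range (24 * M + 1) ×ˢ range (24 * M + 1) ×ˢ range (24 * M + 1) |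
    t.1 ^ 2 + t.2.1 * t.2.2 = 24 * M ∧ 0 < t.2.1 ∧ t.2.1 < t.2.2 ∧ ¬ 2 ∣ t.1 ∧ ¬ 3 ∣ t.1}

theorem mem_triples {M x d e : ℕ} : (x, d, e) ∈ triples M ↔
    x ^ 2 + d * e = 24 * M ∧ 0 < d ∧ d < e ∧ ¬ 2 ∣ x ∧ ¬ 3 ∣ x := by
  simp only [triples, mem_filter, mem_product, mem_range, and_iff_right_iff_imp]
  rintro ⟨h, hd, hde, h2, -⟩
  have hx : 0 < x := by omega
  refine ⟨?_, ?_, ?_⟩ <;> nlinarith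

theorem int_dvd_sq_sub_one {x : ℤ} (h2 : ¬ 2 ∣ x) (h3 : ¬ 3 ∣ x) : 24 ∣ x ^ 2 - 1 := by
  obtain ⟨k, hk | hk⟩ : ∃ k, x = 6 * k + 1 ∨ x = 6 * k - 1 := ⟨(x + 1) / 6, by omega⟩
  · rcases Int.even_or_odd' k with ⟨c, rfl | rfl⟩
    · exact ⟨6 * c ^ 2 + c, by rw [hk]; ring⟩
    · exact ⟨6 * c ^ 2 + 7 * c + 2, by rw [hk]; ring⟩
  · rcases Int.even_or_odd' k with ⟨c, rfl | rfl⟩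
    · exact ⟨6 * c ^ 2 - c, by rw [hk]; ring⟩
    · exact ⟨6 * c ^ 2 + 5 * c + 1, by rw [hk]; ring⟩

/-- If `x` is prime to `6` and `x ^ 2 + d * e ≡ 0` modulo `24`, then `d` and `e` are prime to `6`
and `d + e ≡ 0` modulo `24`. -/
theorem twentyFour_dvd_add {x d e m : ℤ} (h2 : ¬ 2 ∣ x) (h3 : ¬ 3 ∣ x)
    (h : x ^ 2 + d * e = 24 * m) : 24 ∣ d + e ∧ ¬ 2 ∣ d ∧ ¬ 3 ∣ d := by
  have hx := int_dvd_sq_sub_one h2 h3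
  have hde : 24 ∣ d * e + 1 := by omega
  have hd : ∀ p : ℤ, p ∣ 24 → p ∣ d → p ∣ 1 := by
    intro p hp hpd
    have h1 : p ∣ d * e + 1 := hp.trans hde
    exact (Int.dvd_add_right (hpd.mul_right e)).1 h1
  have hd2 : ¬ 2 ∣ d := fun h => by have := hd 2 (by norm_num) h; omega
  have hd3 : ¬ 3 ∣ d := fun h => by have := hd 3 (by norm_num) h; omega
  refine ⟨?_, hd2, hd3⟩
  -- Both `d * e + 1` and `d ^ 2 - 1` are divisible by 24.
  have e1 : d + e = d * (d * e + 1) - e * (d ^ 2 - 1) := by ring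
  rw [e1]
  exact dvd_sub (hde.mul_left _) ((int_dvd_sq_sub_one hd2 hd3).mul_left _)

/-- Here the equation reads `(x + d) ^ 2 = 24 * M`, which is symmetric in `x` and `d`; the
fixed-point free involution exchanges them. -/
theorem card_degenerate_triples (M : ℕ) :
    (#{t ∈ triples M | t.2.2 = t.2.1 + 2 * t.1} : ZMod 2) = 0 := by
  refine card_eq_zero_of_involution _ (fun t => (t.2.1, t.1, t.1 + 2 * t.2.1)) ?_ ?_ ?_
  all_goals
    rintro ⟨x, d, e⟩ ht
    simp only [mem_filter, mem_triples] at ht ⊢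
    obtain ⟨⟨h, hd, hde, h2, h3⟩, rfl⟩ := ht
  · have key := twentyFour_dvd_add (x := x) (d := d) (e := (d + 2 * x : ℕ)) (m := M)
      (by omega) (by omega) (by exact_mod_cast h)
    refine ⟨⟨by rw [← h]; ring, by omega, by omega, by omega, by omega⟩, trivial⟩
  · simp
  · intro heq
    have hdx : d = x := by simpa using congrArg Prod.fst heq
    subst hdx
    -- With `x = d` the equation becomes `4 * d ^ 2 = 24 * M`, which makes `d` even.
    have h1 : 4 * (d * d) = 4 * (6 * M) := by nlinarith
    have h4 : d * d = 2 * (3 * M) := by omega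
    exact h2 ((Nat.Prime.dvd_mul Nat.prime_two).1 ⟨_, h4⟩ |>.elim id id)

/-! ### Reduction to residue classes modulo `2 * g` -/

/-- The solutions of `3 * z ^ 2 + g * e = 2 * M` with `g` and `e` positive, `e` prime to `6`, and
`z` minimal in its class modulo `2 * g`. -/
noncomputable def reducedTriples (M : ℕ) : Finset (ℤ × ℤ × ℤ) :=
  {t ∈ Icc (-(2 * M : ℤ)) (2 * M) ×ˢ Icc (0 : ℤ) (2 * M) ×ˢ Icc (0 : ℤ) (2 * M) |
    3 * t.1 ^ 2 + t.2.1 * t.2.2 = 2 * M ∧ 0 < t.2.1 ∧ 0 < t.2.2 ∧ ¬ 2 ∣ t.2.2 ∧ ¬ 3 ∣ t.2.2 ∧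
      0 < 12 * t.2.1 - 12 * t.1 - t.2.2}

theorem mem_reducedTriples {M : ℕ} {z g e : ℤ} : (z, g, e) ∈ reducedTriples M ↔
    3 * z ^ 2 + g * e = 2 * M ∧ 0 < g ∧ 0 < e ∧ ¬ 2 ∣ e ∧ ¬ 3 ∣ e ∧ 0 < 12 * g - 12 * z - e := by
  simp only [reducedTriples, mem_filter, mem_product, mem_Icc, and_iff_right_iff_imp]
  rintro ⟨h, hg, he, -, -, -⟩
  refine ⟨⟨?_, ?_⟩, ⟨hg.le, ?_⟩, he.le, ?_⟩ <;> nlinarith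

/-- With `x₁ = 6 * z + e` and `d₁ = 12 * g - 12 * z - e` one has `x₁ ^ 2 + d₁ * e = 12 * (3 * z ^ 2
+ g * e)`. Conversely, sign changes of `x` and swaps of `d` and `e` give four candidates. As `d + e
≡ 0` modulo 24, exactly two of them satisfy `x₁ ≡ e₁` modulo 6. Their values of `12 * g = d₁ + 2 *
x₁ - e₁` are opposite, and nonzero outside the degenerate case, so exactly one has `g > 0`. -/
theorem card_nondegenerate_triples (M : ℕ) :
    #{t ∈ triples M | ¬ t.2.2 = t.2.1 + 2 * t.1} = #(reducedTriples M) := by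
  symm
  refine card_bij (fun t _ => ((6 * t.1 + t.2.2).natAbs,
    (min (12 * t.2.1 - 12 * t.1 - t.2.2) t.2.2).toNat,
    (max (12 * t.2.1 - 12 * t.1 - t.2.2) t.2.2).toNat)) ?_ ?_ ?_
  · rintro ⟨z, g, e⟩ ht
    rw [mem_reducedTriples] at ht
    obtain ⟨h, hg, he, h2, h3, hd⟩ := ht
    simp only [mem_filter, mem_triples]
    refine ⟨⟨?_, by omega, by omega, by omega, by omega⟩, by omega⟩
    zify
    rw [sq_abs, Int.toNat_of_nonneg (by omega), Int.toNat_of_nonneg (by omega), min_mul_max]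
    linear_combination 12 * h
  · rintro ⟨z, g, e⟩ ht ⟨z', g', e'⟩ ht' heq
    rw [mem_reducedTriples] at ht ht'
    obtain ⟨-, hg, he, h2, h3, hd⟩ := ht
    obtain ⟨-, hg', he', h2', h3', hd'⟩ := ht'
    simp only [Prod.mk.injEq] at heq ⊢
    omega
  · rintro ⟨x, d, e⟩ ht
    simp only [mem_filter, mem_triples] at ht
    obtain ⟨⟨h, hd, hde, h2, h3⟩, hne⟩ := ht
    have h' : (x : ℤ) ^ 2 + d * e = 24 * M := by exact_mod_cast h
    obtain ⟨hde24, hd2, hd3⟩ := twentyFour_dvd_add (by omega) (by omega) h'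
    have hx : 0 < x := by omega
    suffices ∃ x₁ d₁ e₁ z g : ℤ, x₁ ^ 2 + d₁ * e₁ = 24 * M ∧ 0 < d₁ ∧ 0 < e₁ ∧
        x₁.natAbs = x ∧ (d₁ = d ∧ e₁ = e ∨ d₁ = e ∧ e₁ = d) ∧ x₁ - e₁ = 6 * z ∧
        d₁ + 2 * x₁ - e₁ = 12 * g ∧ 0 < g by
      obtain ⟨x₁, d₁, e₁, z, g, h₁, hd₁, he₁, hx₁, hc, hz, hg, hg0⟩ := this
      refine ⟨(z, g, e₁), ?_, ?_⟩
      · rw [mem_reducedTriples]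
        refine ⟨?_, hg0, he₁, by omega, by omega, by omega⟩
        have ez : x₁ = 6 * z + e₁ := by omega
        have ed : d₁ = 12 * g - 12 * z - e₁ := by omega
        rw [ez, ed] at h₁
        linarith
      · simp only [Prod.mk.injEq]
        omega
    by_cases h3e : (3 : ℤ) ∣ x - e
    · by_cases hlt : (e : ℤ) < d + 2 * x
      · exact ⟨x, d, e, (x - e) / 6, (d + 2 * x - e) / 12, h', by omega, by omega, by omega,
          by omega, by omega, by omega, by omega⟩
      · exact ⟨-x, e, d, (-x - d) / 6, (e - 2 * x - d) / 12, by linarith, by omega, by omega,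
          by omega, by omega, by omega, by omega, by omega⟩
    · have h3d : (3 : ℤ) ∣ x - d := by
        have hx3 : (x : ℤ) % 3 = 1 ∨ (x : ℤ) % 3 = 2 := by omega
        have hd3 : (d : ℤ) % 3 = 1 ∨ (d : ℤ) % 3 = 2 := by omega
        rcases hx3 with h | h <;> rcases hd3 with h' | h' <;> omega
      have h6 : (6 : ℤ) ∣ x - d := by omega
      exact ⟨x, e, d, (x - d) / 6, (e + 2 * x - d) / 12, by linarith, by omega, by omega,
        by omega, by omega, by omega, by omega, by omega⟩

theorem exists_three_mul_sq_lt_iff {M : ℕ} (hM : 0 < M) :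
    ∃ R : ℤ, 0 ≤ R ∧ ∀ z : ℤ, 3 * z ^ 2 < 2 * M ↔ -R ≤ z ∧ z ≤ R := by
  refine ⟨Nat.sqrt ((2 * M - 1) / 3), by positivity, fun z => ?_⟩
  rw [← abs_le, Int.abs_eq_natAbs, ← Int.natAbs_sq z, Nat.cast_le, Nat.le_sqrt']
  rw [Nat.le_div_iff_mul_le (by norm_num)]
  zify
  omega

/-- In terms of the largest `R` with `3 * R ^ 2 < 2 * M`, the condition of minimality says
that `z` is the smallest element of its class modulo `2 * g` that is not below `-R`. -/
theorem mem_reducedTriples_iff {M : ℕ} {R z g e : ℤ}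
    (hR : ∀ z : ℤ, 3 * z ^ 2 < 2 * M ↔ -R ≤ z ∧ z ≤ R) : (z, g, e) ∈ reducedTriples M ↔
    3 * z ^ 2 + g * e = 2 * M ∧ 0 < g ∧ ¬ 2 ∣ e ∧ ¬ 3 ∣ e ∧ -R ≤ z ∧ z ≤ R ∧ z - 2 * g < -R := by
  rw [mem_reducedTriples]
  constructor
  · rintro ⟨h, hg, he, h2, h3, hd⟩
    have hz := (hR z).1 (by nlinarith)
    refine ⟨h, hg, h2, h3, hz.1, hz.2, ?_⟩
    -- This product equals `3 * (z - 2 * g) ^ 2 - 2 * M`, so its positivity puts `z - 2 * g` outside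
    -- `[-R, R]`.
    have hgd : 0 < g * (12 * g - 12 * z - e) := mul_pos hg hd
    have := mt (hR (z - 2 * g)).2 (by nlinarith)
    omega
  · rintro ⟨h, hg, h2, h3, hz1, hz2, hzg⟩
    have hz := (hR z).2 ⟨hz1, hz2⟩
    have hnot := mt (hR (z - 2 * g)).1 (by omega)
    refine ⟨h, hg, pos_of_mul_pos_right (by linarith : 0 < g * e) hg.le, h2, h3, ?_⟩
    have hgd : 0 ≤ g * (12 * g - 12 * z - e) := by nlinarith
    -- The inequality becomes strict because `e` is odd.
    have := nonneg_of_mul_nonneg_right hgd hg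
    omega

/-! ### The involution `z ↦ -z` and its fixed points -/

/-- The involution sending the class of `z` modulo `2 * g` to the class of `-z`. -/
def negClass (R : ℤ) (t : ℤ × ℤ × ℤ) : ℤ × ℤ × ℤ :=
  ((R - t.1) % (2 * t.2.1) - R, t.2.1, t.2.2 - 12 * t.1 * ((R - t.1) / (2 * t.2.1))
    - 12 * t.2.1 * ((R - t.1) / (2 * t.2.1)) ^ 2)

/-- The interval `[-R, R]` is symmetric, so the class of `-z` meets it as well. The third entry
changes by a multiple of 12 and stays prime to 6. -/
theorem negClass_mem {M : ℕ} {R : ℤ} (hR : ∀ z : ℤ, 3 * z ^ 2 < 2 * M ↔ -R ≤ z ∧ z ≤ R)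
    {t : ℤ × ℤ × ℤ} (ht : t ∈ reducedTriples M) : negClass R t ∈ reducedTriples M := by
  obtain ⟨z, g, e⟩ := t
  unfold negClass
  rw [mem_reducedTriples_iff hR] at ht ⊢
  obtain ⟨h, hg, h2, h3, hz1, hz2, hzg⟩ := ht
  dsimp only
  have hdiv := Int.emod_add_mul_ediv (R - z) (2 * g)
  have hlt := Int.emod_lt_of_pos (R - z) (by omega : 0 < 2 * g)
  have hnn := Int.emod_nonneg (R - z) (by omega : 2 * g ≠ 0)
  have hk : 0 ≤ (R - z) / (2 * g) := Int.ediv_nonneg (by omega) (by omega)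
  generalize (R - z) % (2 * g) = u at *
  generalize (R - z) / (2 * g) = k at *
  have hu : u = R - z - 2 * g * k := by linarith
  have hgk : 0 ≤ g * k := mul_nonneg hg.le hk
  refine ⟨?_, hg, ?_, ?_, by omega, by linarith, by omega⟩
  · rw [hu]
    linear_combination h
  · rw [mul_assoc, mul_assoc]
    omega
  · rw [mul_assoc, mul_assoc]
    omega

/-- Only the first entry needs computing: the second never changes, and the equation then determines
the third. -/
theorem negClass_negClass {M : ℕ} {R : ℤ} (hR : ∀ z : ℤ, 3 * z ^ 2 < 2 * M ↔ -R ≤ z ∧ z ≤ R)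
    {t : ℤ × ℤ × ℤ} (ht : t ∈ reducedTriples M) : negClass R (negClass R t) = t := by
  have ht' := negClass_mem hR (negClass_mem hR ht)
  have hz : (negClass R (negClass R t)).1 = t.1 := by
    obtain ⟨z, g, e⟩ := t
    rw [mem_reducedTriples_iff hR] at ht
    obtain ⟨h, hg, h2, h3, hz1, hz2, hzg⟩ := ht
    simp only [negClass]
    have h1 : (R - ((R - z) % (2 * g) - R)) % (2 * g) = (z + R) % (2 * g) := by
      rw [← Int.emod_add_mul_ediv (R - z) (2 * g)]
      apply Int.emod_emod_of_dvd _ (dvd_refl _) |>.symm.trans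
      have := Int.emod_add_mul_ediv (R - z) (2 * g)
      apply Int.emod_emod_of_dvd _ (dvd_refl _) |>.trans
      apply Int.ModEq.symm
      apply Int.modEq_iff_dvd.2
      rw [Int.emod_add_mul_ediv]
      exact ⟨(R - z) / (2 * g), by linarith⟩
    rw [h1, Int.emod_eq_of_lt (by omega) (by omega)]
    ring
  have hg : (negClass R (negClass R t)).2.1 = t.2.1 := rfl
  obtain ⟨z, g, e⟩ := t
  generalize negClass R (negClass R (z, g, e)) = t' at *
  obtain ⟨z', g', e'⟩ := t'
  dsimp only at hz hg
  subst hz hg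
  rw [mem_reducedTriples] at ht ht'
  have : g' * e' = g' * e := by linarith [ht.1, ht'.1]
  rw [mul_left_cancel₀ (ne_of_gt ht.2.1) this]

/-- The classes of `z` and `-z` modulo `2 * g` coincide exactly when `2 * g ∣ 2 * z`. -/
theorem negClass_eq_self_iff {M : ℕ} {R : ℤ} (hR : ∀ z : ℤ, 3 * z ^ 2 < 2 * M ↔ -R ≤ z ∧ z ≤ R)
    {t : ℤ × ℤ × ℤ} (ht : t ∈ reducedTriples M) : negClass R t = t ↔ t.2.1 ∣ t.1 := by
  have ht' := negClass_mem hR ht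
  obtain ⟨z, g, e⟩ := t
  have ht₀ := ht
  rw [mem_reducedTriples_iff hR] at ht₀
  obtain ⟨h, hg, h2, h3, hz1, hz2, hzg⟩ := ht₀
  constructor
  · intro heq
    have h1 : (R - z) % (2 * g) - R = z := congrArg Prod.fst heq
    have h2 := Int.emod_add_mul_ediv (R - z) (2 * g)
    exact ⟨-((R - z) / (2 * g)), by linarith⟩
  · rintro ⟨k, hk⟩
    dsimp only at hk
    have h1 : (R - z) % (2 * g) = z + R := by
      rw [← Int.emod_eq_of_lt (by omega : 0 ≤ z + R) (by omega : z + R < 2 * g)]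
      apply Int.modEq_iff_dvd.2
      exact ⟨k, by rw [hk]; ring⟩
    have hz' : (negClass R (z, g, e)).1 = z := by
      simp only [negClass, h1]
      ring
    have hg' : (negClass R (z, g, e)).2.1 = g := rfl
    generalize negClass R (z, g, e) = t' at *
    obtain ⟨z', g', e'⟩ := t'
    dsimp only at hz' hg'
    subst hz' hg'
    rw [mem_reducedTriples] at ht ht'
    have : g' * e' = g' * e := by linarith [ht.1, ht'.1]
    rw [mul_left_cancel₀ (ne_of_gt ht.2.1) this]

/-- The classes of `0` and of `g` modulo `2 * g` are treated together: they are the multiples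
`g * k` with `k ≡ c` modulo `2`, for `c = 0` and for `c = 1`. -/
theorem card_fixed_class {M : ℕ} {R : ℤ} (hM : 0 < M)
    (hR : ∀ z : ℤ, 3 * z ^ 2 < 2 * M ↔ -R ≤ z ∧ z ≤ R) (c : ℕ) (hc : c < 2) :
    #{t ∈ reducedTriples M | 2 * t.2.1 ∣ t.1 - (c : ℤ) * t.2.1} =
      #{x ∈ (2 * M).divisorsAntidiagonal | c * x.1 ≤ R ∧ Odd (x.2 + c * x.1) ∧ ¬ 3 ∣ x.2} := by
  have hcc : (c : ℤ) ^ 2 = c := by interval_cases c <;> simp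
  refine card_bij (fun t _ => (t.2.1.toNat, (2 * M / t.2.1).toNat)) ?_ ?_ ?_
  · rintro ⟨z, g, e⟩ ht
    rw [mem_filter, mem_reducedTriples_iff hR] at ht
    obtain ⟨⟨h, hg, h2, h3, hz1, hz2, hzg⟩, k, hk'⟩ := ht
    dsimp only at hk'
    have hk : z = g * (2 * k + c) := by linear_combination hk'
    have hprod : (2 * M : ℤ) = g * (e + 3 * g * (2 * k + c) ^ 2) := by
      rw [← h, hk]
      ring
    have hdiv : (2 * M : ℤ) / g = e + 3 * g * (2 * k + c) ^ 2 := by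
      rw [hprod, Int.mul_ediv_cancel_left _ hg.ne']
    have hpos : 0 < e + 3 * g * (2 * k + c) ^ 2 :=
      pos_of_mul_pos_right (by rw [← hprod]; omega) hg.le
    simp only [mem_filter, Nat.mem_divisorsAntidiagonal, hdiv]
    -- As `c ^ 2 = c`, the cofactor of `g` is `e + 3 * g * c` modulo 6: it has the parity of `e + g
    -- * c` and the residue of `e` modulo 3.
    have hexp : e + 3 * g * (2 * k + c) ^ 2 = e + 3 * (2 * (2 * g * (k * k + k * c)) + g * c) := by
      linear_combination 3 * g * hcc
    refine ⟨⟨?_, by omega⟩, ?_, ?_, ?_⟩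
    · zify
      rw [Int.toNat_of_nonneg hg.le, Int.toNat_of_nonneg hpos.le, ← hprod]
    · rw [Int.toNat_of_nonneg hg.le]
      interval_cases c
      · simp
        omega
      -- An odd multiple of `g` lying in `[-R, R]` forces `g ≤ R`.
      · simp only [Nat.cast_one] at *
        rcases le_or_gt 0 k with hk0 | hk0 <;> nlinarith
    · rw [Nat.odd_iff]
      zify
      rw [Int.toNat_of_nonneg hg.le, Int.toNat_of_nonneg hpos.le, hexp, mul_comm (c : ℤ)]
      omega
    · zify
      rw [Int.toNat_of_nonneg hpos.le, hexp]
      omega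
  · rintro ⟨z, g, e⟩ ht ⟨z', g', e'⟩ ht' heq
    rw [mem_filter, mem_reducedTriples_iff hR] at ht ht'
    obtain ⟨⟨h, hg, h2, h3, hz1, hz2, hzg⟩, k, hk⟩ := ht
    obtain ⟨⟨h', hg', h2', h3', hz1', hz2', hzg'⟩, k', hk'⟩ := ht'
    simp only [Prod.mk.injEq] at heq
    obtain rfl : g = g' := by omega
    dsimp only at hk hk'
    have hzz : z - z' = 0 := by
      refine Int.eq_zero_of_abs_lt_dvd (m := 2 * g) ⟨k - k', ?_⟩ ?_
      · linear_combination hk - hk'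
      · rw [abs_lt]
        omega
    obtain rfl : z = z' := by omega
    have : g * e = g * e' := by linarith
    rw [mul_left_cancel₀ hg.ne' this]
  · rintro ⟨g, m⟩ hx
    simp only [mem_filter, Nat.mem_divisorsAntidiagonal] at hx
    obtain ⟨⟨hgm, -⟩, hcg, hodd, h3⟩ := hx
    have hg : (0 : ℤ) < g := by
      rcases Nat.eq_zero_or_pos g with rfl | h
      · omega
      · exact_mod_cast h
    have hgm' : (g : ℤ) * m = 2 * M := by exact_mod_cast hgm
    have hdiv := Int.emod_add_mul_ediv (R - c * g) (2 * g)
    have hlt := Int.emod_lt_of_pos (R - c * g) (by omega : (0 : ℤ) < 2 * g)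
    have hnn := Int.emod_nonneg (R - c * g) (by omega : (2 * g : ℤ) ≠ 0)
    have hk : 0 ≤ (R - c * g) / (2 * g) := Int.ediv_nonneg (by omega) (by omega)
    generalize (R - c * g) % (2 * g) = u at *
    generalize (R - c * g) / (2 * g) = k at *
    have hgk : 0 ≤ g * k := mul_nonneg hg.le hk
    have hcg0 : (0 : ℤ) ≤ c * g := by positivity
    -- The largest element of the class up to `R` is `c * g + 2 * g * k`; its negative is in the
    -- same class and is the smallest element not below `-R`.
    refine ⟨(g * (2 * (-k - c) + c), g, m - 3 * g * (2 * (-k - c) + c) ^ 2), ?_, ?_⟩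
    · rw [mem_filter, mem_reducedTriples_iff hR]
      have hexp : (m : ℤ) - 3 * g * (2 * (-k - c) + c) ^ 2 =
          m - 3 * (2 * (2 * g * (k * k + k * c)) + g * c) := by
        linear_combination -3 * g * hcc
      rw [Nat.odd_iff] at hodd
      zify at hodd
      rw [mul_comm (c : ℤ)] at hodd
      refine ⟨⟨by linear_combination hgm', hg, ?_, ?_, ?_, ?_, ?_⟩, -k - c, by ring⟩
      · rw [hexp]
        omega
      · rw [hexp]
        omega
      · linarith
      · linarith
      · linarith
    · simp only [← hgm', Int.mul_ediv_cancel_left _ hg.ne', Int.toNat_natCast]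

/-- The parity of the number of solutions of `x ^ 2 + d * e = 24 * M`, `0 < d < e`, `x` prime
to `6`. -/
theorem card_triples {M : ℕ} (hM : 0 < M) : (#(triples M) : ZMod 2) =
    #{x ∈ oppositeFactors (2 * M) | x.1 < x.2} +
      #{x ∈ oppositeFactors (2 * M) | 3 * x.1 < x.2} := by
  obtain ⟨R, hR0, hR⟩ := exists_three_mul_sq_lt_iff hM
  rw [← card_filter_add_card_filter_not (s := triples M) (fun t => t.2.2 = t.2.1 + 2 * t.1),
    Nat.cast_add, card_degenerate_triples, zero_add, card_nondegenerate_triples,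
    card_eq_card_fixed _ (negClass R) (fun t ht => negClass_mem hR ht)
      (fun t ht => negClass_negClass hR ht),
    filter_congr (fun t ht => negClass_eq_self_iff hR ht),
    ← card_oppositeFactors_combination, ← Nat.cast_add]
  congr 1
  have hsplit : {t ∈ reducedTriples M | t.2.1 ∣ t.1} =
      {t ∈ reducedTriples M | 2 * t.2.1 ∣ t.1 - ((0 : ℕ) : ℤ) * t.2.1} ∪
        {t ∈ reducedTriples M | 2 * t.2.1 ∣ t.1 - ((1 : ℕ) : ℤ) * t.2.1} := by
    ext ⟨z, g, e⟩
    rw [mem_union, mem_filter, mem_filter, mem_filter, ← and_or_left]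
    refine and_congr_right fun _ => ?_
    simp only [Nat.cast_zero, zero_mul, sub_zero, Nat.cast_one, one_mul]
    constructor
    · rintro ⟨k, hk⟩
      rcases Int.even_or_odd' k with ⟨j, rfl | rfl⟩
      · exact Or.inl ⟨j, by rw [hk]; ring⟩
      · exact Or.inr ⟨j, by rw [hk]; ring⟩
    · rintro (⟨k, hk⟩ | ⟨k, hk⟩)
      · exact ⟨2 * k, by rw [hk]; ring⟩
      · exact ⟨2 * k + 1, by linear_combination hk⟩
  rw [hsplit, card_union_of_disjoint, card_fixed_class hM hR 0 (by norm_num),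
    card_fixed_class hM hR 1 (by norm_num)]
  · congr 2
    · ext ⟨a, b⟩
      simp only [mem_filter, mem_oppositeFactors, Nat.mem_divisorsAntidiagonal, Nat.cast_zero,
        zero_mul, add_zero, hR0, true_and]
      constructor
      · rintro ⟨⟨h1, h2⟩, h3, h4⟩
        have ha : Even (a * b) := ⟨M, by omega⟩
        have hb : Even a := (Nat.even_mul.1 ha).resolve_right (Nat.not_even_iff_odd.2 h3)
        exact ⟨⟨⟨h1, h2⟩, hb.add_odd h3⟩, h3, h4⟩
      · rintro ⟨⟨⟨h1, h2⟩, -⟩, h3, h4⟩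
        exact ⟨⟨h1, h2⟩, h3, h4⟩
    · ext ⟨a, b⟩
      simp only [mem_filter, mem_oppositeFactors, Nat.mem_divisorsAntidiagonal, Nat.cast_one,
        one_mul]
      rw [add_comm b a]
      -- For `a > 0`, `3 * a ^ 2 < 2 * M = a * b` cancels to `3 * a < b`.
      have key : a * b = 2 * M → ((a : ℤ) ≤ R ↔ 3 * a < b) := by
        intro hab
        have h1 : (a : ℤ) ≤ R ↔ 3 * (a : ℤ) ^ 2 < 2 * M := by
          rw [hR]
          omega
        rw [h1]
        norm_cast
        have ha : 0 < a := Nat.pos_of_ne_zero (by rintro rfl; omega)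
        rw [← hab, ← Nat.mul_lt_mul_left ha (b := 3 * a)]
        ring_nf
      constructor
      · rintro ⟨⟨h1, h2⟩, h3, h4, h5⟩
        exact ⟨⟨⟨h1, h2⟩, h4⟩, (key h1).1 h3, h5⟩
      · rintro ⟨⟨⟨h1, h2⟩, h4⟩, h3, h5⟩
        exact ⟨⟨h1, h2⟩, (key h1).2 h3, h4, h5⟩
  · rw [disjoint_filter]
    rintro ⟨z, g, e⟩ ht ⟨k, hk⟩ ⟨j, hj⟩
    rw [mem_reducedTriples] at ht
    dsimp only at hk hj
    push_cast at hk hj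
    have : g * (2 * k) = g * (2 * j + 1) := by linear_combination hj - hk
    have := mul_left_cancel₀ ht.2.1.ne' this
    omega

/-! ### Counting partitions by a property of their multiset of parts -/

open Classical in
/-- The number of partitions of `n` whose multiset of parts has the property `Q`. -/
noncomputable def partitionCount (Q : Multiset ℕ → Prop) (n : ℕ) : ℕ :=
  #{p : Nat.Partition n | Q p.parts}

theorem partitionCount_congr {Q Q' : Multiset ℕ → Prop} {n : ℕ}
    (h : ∀ s : Multiset ℕ, 0 ∉ s → s.sum = n → (Q s ↔ Q' s)) :
    partitionCount Q n = partitionCount Q' n := by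
  unfold partitionCount
  congr 1
  ext p
  simp only [mem_filter]
  rw [h p.parts (fun h0 => (p.parts_pos h0).ne' rfl) p.parts_sum]

theorem partitionCount_eq_zero {Q : Multiset ℕ → Prop} {n : ℕ}
    (h : ∀ s : Multiset ℕ, 0 ∉ s → s.sum = n → ¬ Q s) : partitionCount Q n = 0 := by
  classical
  unfold partitionCount
  rw [card_eq_zero, filter_eq_empty_iff]
  exact fun p _ => h p.parts (fun h0 => (p.parts_pos h0).ne' rfl) p.parts_sum

/-- This allows bijections of partitions to be given by plain maps of multisets, defined also where
they are meaningless. -/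
theorem partitionCount_eq_of_inverse {Q Q' : Multiset ℕ → Prop} {n n' : ℕ}
    (f g : Multiset ℕ → Multiset ℕ)
    (hf : ∀ s : Multiset ℕ, 0 ∉ s → s.sum = n → Q s →
      0 ∉ f s ∧ (f s).sum = n' ∧ Q' (f s) ∧ g (f s) = s)
    (hg : ∀ s : Multiset ℕ, 0 ∉ s → s.sum = n' → Q' s →
      0 ∉ g s ∧ (g s).sum = n ∧ Q (g s) ∧ f (g s) = s) :
    partitionCount Q n = partitionCount Q' n' := by
  classical
  have h0 : ∀ {k : ℕ} (p : Nat.Partition k), 0 ∉ p.parts :=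
    fun p h => (p.parts_pos h).ne' rfl
  unfold partitionCount
  refine card_bij'
    (fun p hp => ⟨f p.parts, fun {i} hi => Nat.pos_of_ne_zero ?_, ?_⟩)
    (fun p hp => ⟨g p.parts, fun {i} hi => Nat.pos_of_ne_zero ?_, ?_⟩) ?_ ?_ ?_ ?_
  · rintro rfl
    exact (hf p.parts (h0 p) p.parts_sum (mem_filter.1 hp).2).1 hi
  · exact (hf p.parts (h0 p) p.parts_sum (mem_filter.1 hp).2).2.1
  · rintro rfl
    exact (hg p.parts (h0 p) p.parts_sum (mem_filter.1 hp).2).1 hi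
  · exact (hg p.parts (h0 p) p.parts_sum (mem_filter.1 hp).2).2.1
  · intro p hp
    exact mem_filter.2 ⟨mem_univ _, (hf p.parts (h0 p) p.parts_sum (mem_filter.1 hp).2).2.2.1⟩
  · intro p hp
    exact mem_filter.2 ⟨mem_univ _, (hg p.parts (h0 p) p.parts_sum (mem_filter.1 hp).2).2.2.1⟩
  · intro p hp
    ext1
    exact (hf p.parts (h0 p) p.parts_sum (mem_filter.1 hp).2).2.2.2
  · intro p hp
    ext1
    exact (hg p.parts (h0 p) p.parts_sum (mem_filter.1 hp).2).2.2.2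

theorem partitionCount_and_add_and_not (Q R : Multiset ℕ → Prop) (n : ℕ) :
    partitionCount (fun s => Q s ∧ R s) n + partitionCount (fun s => Q s ∧ ¬ R s) n =
      partitionCount Q n := by
  classical
  unfold partitionCount
  rw [← card_filter_add_card_filter_not (s := {p : Nat.Partition n | Q p.parts})
    (fun p => R p.parts), filter_filter, filter_filter]
  congr!

theorem partitionCount_add_not (Q : Multiset ℕ → Prop) (n : ℕ) :
    partitionCount Q n + partitionCount (fun s => ¬ Q s) n = Fintype.card (Nat.Partition n) := by
  classical
  unfold partitionCount
  rw [card_filter_add_card_filter_not, card_univ]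

theorem partitionCount_eq_sum {Q : Multiset ℕ → Prop} {n : ℕ} (I : Finset ℕ)
    (Q' : ℕ → Multiset ℕ → Prop)
    (h : ∀ s : Multiset ℕ, 0 ∉ s → s.sum = n → (Q s ↔ ∃ w ∈ I, Q' w s))
    (huniq : ∀ w w' s, Q' w s → Q' w' s → w = w') :
    partitionCount Q n = ∑ w ∈ I, partitionCount (Q' w) n := by
  classical
  unfold partitionCount
  rw [← card_biUnion]
  · congr 1
    ext p
    simp only [mem_filter, mem_univ, true_and, mem_biUnion]
    rw [h p.parts (fun h0 => (p.parts_pos h0).ne' rfl) p.parts_sum]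
  · intro w _ w' _ hww
    refine disjoint_filter.2 ?_
    exact fun p _ hp hp' => hww (huniq w w' _ hp hp')

/-! ### Multisets of positive integers -/

theorem sup_mem_of_ne_zero {s : Multiset ℕ} (hs : s ≠ 0) : s.sup ∈ s := by
  induction s using Multiset.induction with
  | empty => exact absurd rfl hs
  | cons a s ih =>
    rw [Multiset.sup_cons]
    rcases eq_or_ne s 0 with rfl | h
    · simp
    · rcases le_total a s.sup with h' | h'
      · rw [sup_eq_right.2 h']
        exact Multiset.mem_cons_of_mem (ih h)
      · rw [sup_eq_left.2 h']
        exact Multiset.mem_cons_self a s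

theorem sup_le_sum (s : Multiset ℕ) : s.sup ≤ s.sum :=
  Multiset.sup_le.2 fun _ h => Multiset.le_sum_of_mem h

theorem card_le_sum_of_zero_notMem {s : Multiset ℕ} (h0 : 0 ∉ s) : s.card ≤ s.sum := by
  have := Multiset.card_nsmul_le_sum (s := s) (a := 1)
    (fun x hx => Nat.one_le_iff_ne_zero.2 (by rintro rfl; exact h0 hx))
  simpa using this

theorem sum_map_pred_add_card {s : Multiset ℕ} (h0 : 0 ∉ s) :
    (s.map Nat.pred).sum + s.card = s.sum := by
  induction s using Multiset.induction with
  | empty => rfl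
  | cons a s ih =>
    rw [Multiset.mem_cons, not_or] at h0
    have := ih h0.2
    rw [Multiset.map_cons, Multiset.sum_cons, Multiset.card_cons, Multiset.sum_cons,
      Nat.pred_eq_sub_one]
    have : 0 < a := Nat.pos_of_ne_zero (Ne.symm h0.1)
    omega

theorem sum_map_succ (s : Multiset ℕ) : (s.map Nat.succ).sum = s.sum + s.card := by
  induction s using Multiset.induction with
  | empty => rfl
  | cons a s ih =>
    simp only [Multiset.map_cons, Multiset.sum_cons, Multiset.card_cons, ih]
    omega

theorem sum_filter_ne_zero (s : Multiset ℕ) : (s.filter (· ≠ 0)).sum = s.sum := by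
  induction s using Multiset.induction with
  | empty => rfl
  | cons a s ih => rcases eq_or_ne a 0 with rfl | h <;> simp_all

theorem map_pred_map_succ (s : Multiset ℕ) : (s.map Nat.succ).map Nat.pred = s := by
  simp [Multiset.map_map]

theorem filter_ne_zero_of_zero_notMem {s : Multiset ℕ} (h0 : 0 ∉ s) : s.filter (· ≠ 0) = s :=
  Multiset.filter_eq_self.2 fun a ha => by rintro rfl; exact h0 ha

/-- Lowering loses only the elements `w + 1`, which drop to `w`; their number suffices to undo it.
-/
theorem map_succ_filter_map_pred {w : ℕ} {s : Multiset ℕ} (hs : ∀ a ∈ s, w < a) :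
    ((s.map Nat.pred).filter (w < ·)).map Nat.succ +
      Multiset.replicate (s.count (w + 1)) (w + 1) = s := by
  induction s using Multiset.induction with
  | empty => rfl
  | cons a s ih =>
    have ih' := ih fun b hb => hs b (Multiset.mem_cons_of_mem hb)
    have ha := hs a (Multiset.mem_cons_self a s)
    rcases eq_or_ne a (w + 1) with rfl | h
    · rw [Multiset.map_cons, Multiset.filter_cons_of_neg _ (by simp), Multiset.count_cons_self,
        Multiset.replicate_succ, Multiset.add_cons, ih']
    · rw [Multiset.map_cons,
        Multiset.filter_cons_of_pos _ (by simp only [Nat.pred_eq_sub_one]; omega),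
        Multiset.count_cons_of_ne (Ne.symm h), Multiset.map_cons, Multiset.cons_add, ih']
      congr 1
      simp only [Nat.pred_eq_sub_one, Nat.succ_eq_add_one]
      omega

theorem filter_le_map_pred {w : ℕ} {s : Multiset ℕ} (hs : ∀ a ∈ s, w < a) :
    (s.map Nat.pred).filter (· ≤ w) = Multiset.replicate (s.count (w + 1)) w := by
  induction s using Multiset.induction with
  | empty => rfl
  | cons a s ih =>
    have ih' := ih fun b hb => hs b (Multiset.mem_cons_of_mem hb)
    have ha := hs a (Multiset.mem_cons_self a s)
    rcases eq_or_ne a (w + 1) with rfl | h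
    · rw [Multiset.map_cons, Multiset.filter_cons_of_pos _ (by simp), Multiset.count_cons_self,
        Multiset.replicate_succ, ih']
      rfl
    · rw [Multiset.map_cons,
        Multiset.filter_cons_of_neg _ (by simp only [Nat.pred_eq_sub_one]; omega),
        Multiset.count_cons_of_ne (Ne.symm h), ih']

/-! ### Removing and inserting columns -/

/-- The parts that remain when the first column of the Ferrers diagram is removed. -/
def dropColumn (s : Multiset ℕ) : Multiset ℕ := (s.map Nat.pred).filter (· ≠ 0)

/-- The parts that arise when a first column of height `k` is put before the Ferrers diagram. -/
def addColumn (k : ℕ) (s : Multiset ℕ) : Multiset ℕ :=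
  s.map Nat.succ + Multiset.replicate (k - s.card) 1

theorem zero_notMem_dropColumn (s : Multiset ℕ) : 0 ∉ dropColumn s := by simp [dropColumn]

theorem zero_notMem_addColumn (k : ℕ) (s : Multiset ℕ) : 0 ∉ addColumn k s := by
  simp [addColumn, Multiset.mem_replicate]

theorem sum_dropColumn {s : Multiset ℕ} (h0 : 0 ∉ s) : (dropColumn s).sum + s.card = s.sum := by
  rw [dropColumn, sum_filter_ne_zero, sum_map_pred_add_card h0]

theorem card_dropColumn_le (s : Multiset ℕ) : (dropColumn s).card ≤ s.card := by
  exact (Multiset.card_le_card (Multiset.filter_le _ _)).trans (Multiset.card_map _ _).le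

theorem card_addColumn {k : ℕ} {s : Multiset ℕ} (h : s.card ≤ k) : (addColumn k s).card = k := by
  simp [addColumn, h]

theorem sum_addColumn {k : ℕ} {s : Multiset ℕ} (h : s.card ≤ k) :
    (addColumn k s).sum = s.sum + k := by
  simp only [addColumn, Multiset.sum_add, sum_map_succ, Multiset.sum_replicate, smul_eq_mul]
  omega

theorem dropColumn_addColumn (k : ℕ) {s : Multiset ℕ} (h0 : 0 ∉ s) :
    dropColumn (addColumn k s) = s := by
  rw [dropColumn, addColumn, Multiset.map_add, map_pred_map_succ, Multiset.filter_add,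
    filter_ne_zero_of_zero_notMem h0, Multiset.map_replicate, add_eq_left,
    Multiset.filter_eq_nil]
  intro a ha
  simp [Multiset.eq_of_mem_replicate ha]

theorem addColumn_dropColumn {s : Multiset ℕ} (h0 : 0 ∉ s) :
    addColumn s.card (dropColumn s) = s := by
  have hpos : ∀ a ∈ s, 0 < a := fun a ha => Nat.pos_of_ne_zero (by rintro rfl; exact h0 ha)
  have h := map_succ_filter_map_pred hpos
  have hf : dropColumn s = (s.map Nat.pred).filter (0 < ·) := by
    simp only [dropColumn, Nat.pos_iff_ne_zero]
  have hc := congrArg Multiset.card h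
  rw [← hf] at h hc
  rw [Multiset.card_add, Multiset.card_map, Multiset.card_replicate] at hc
  rw [addColumn, show s.card - (dropColumn s).card = s.count (0 + 1) by omega]
  exact h

theorem sup_dropColumn_le {s : Multiset ℕ} : (dropColumn s).sup ≤ s.sup - 1 := by
  refine Multiset.sup_le.2 fun b hb => ?_
  simp only [dropColumn, Multiset.mem_filter, Multiset.mem_map] at hb
  obtain ⟨⟨a, ha, rfl⟩, -⟩ := hb
  have := Multiset.le_sup ha
  rw [Nat.pred_eq_sub_one]
  omega

theorem sup_addColumn_le (k : ℕ) (s : Multiset ℕ) : (addColumn k s).sup ≤ s.sup + 1 := by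
  refine Multiset.sup_le.2 fun b hb => ?_
  simp only [addColumn, Multiset.mem_add, Multiset.mem_map, Multiset.mem_replicate] at hb
  rcases hb with ⟨a, ha, rfl⟩ | ⟨-, rfl⟩
  · have := Multiset.le_sup ha
    omega
  · omega

/-! ### The rank -/

/-- The number of partitions of `n` with rank at least `r`. -/
noncomputable def rankGE (r n : ℕ) : ℕ := partitionCount (fun s => s.card + r ≤ s.sup) n

theorem rankGE_eq_zero {r n : ℕ} (hr : 0 < r) (h : n ≤ r) : rankGE r n = 0 := by
  refine partitionCount_eq_zero fun s _ hs hle => ?_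
  have h1 := sup_le_sum s
  have h2 : s = 0 := Multiset.card_eq_zero.1 (by omega)
  subst h2
  simp at hle
  omega

/-- The adjoint of Dyson: replace the first column by a new largest part. -/
theorem rankGE_add (r n : ℕ) :
    rankGE r (n + r + 1) + rankGE (r + 3) n = Fintype.card (Nat.Partition n) := by
  rw [← partitionCount_add_not (fun s => s.card + (r + 3) ≤ s.sup), add_comm]
  congr 1
  symm
  refine partitionCount_eq_of_inverse (fun s => (s.card + r + 1) ::ₘ dropColumn s)
    (fun s => addColumn (s.sup - r - 1) (s.erase s.sup)) ?_ ?_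
  · intro s h0 hs hQ
    have h1 := sum_dropColumn h0
    have h2 := card_dropColumn_le s
    have h3 := sup_dropColumn_le (s := s)
    -- The rank is at most `r + 2`, which is just enough for the new part to be a largest one after
    -- the others have lost a column.
    have hsup : ((s.card + r + 1) ::ₘ dropColumn s).sup = s.card + r + 1 := by
      rw [Multiset.sup_cons]
      exact sup_eq_left.2 (by omega)
    refine ⟨?_, ?_, ?_, ?_⟩
    · rw [Multiset.mem_cons, not_or]
      exact ⟨by omega, zero_notMem_dropColumn s⟩
    · rw [Multiset.sum_cons]
      omega
    · rw [hsup, Multiset.card_cons]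
      omega
    · rw [hsup, Multiset.erase_cons_head, show s.card + r + 1 - r - 1 = s.card by omega,
        addColumn_dropColumn h0]
  · intro s h0 hs hQ
    have hne : s ≠ 0 := by
      rintro rfl
      simp at hs
    have hmem := sup_mem_of_ne_zero hne
    have hcard := Multiset.card_erase_add_one hmem
    have hsum := Multiset.sum_erase hmem
    have hsup : (s.erase s.sup).sup ≤ s.sup := Multiset.sup_mono fun a ha =>
      Multiset.mem_of_mem_erase ha
    have h0' : 0 ∉ s.erase s.sup := fun h => h0 (Multiset.mem_of_mem_erase h)
    have hk : (s.erase s.sup).card ≤ s.sup - r - 1 := by omega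
    have h3 := sup_addColumn_le (s.sup - r - 1) (s.erase s.sup)
    refine ⟨zero_notMem_addColumn _ _, ?_, ?_, ?_⟩
    · rw [sum_addColumn hk]
      omega
    · rw [card_addColumn hk]
      omega
    · rw [card_addColumn hk, dropColumn_addColumn _ h0',
        show s.sup - r - 1 + r + 1 = s.sup by omega, Multiset.cons_erase hmem]

/-! ### Partitions with a prescribed number of large parts -/

/-- The number of elements larger than `w`. -/
def largerCount (s : Multiset ℕ) (w : ℕ) : ℕ := s.countP (w < ·)

theorem largerCount_antitone (s : Multiset ℕ) : Antitone (largerCount s) := by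
  intro w w' h
  simp only [largerCount, Multiset.countP_eq_card_filter]
  exact Multiset.card_le_card (Multiset.monotone_filter_right s fun a ha => lt_of_le_of_lt h ha)

theorem largerCount_eq_count_add (s : Multiset ℕ) (w : ℕ) :
    largerCount s w = s.count (w + 1) + largerCount s (w + 1) := by
  unfold largerCount
  induction s using Multiset.induction with
  | empty => rfl
  | cons a s ih =>
    rw [Multiset.countP_cons, Multiset.countP_cons, Multiset.count_cons, ih]
    split_ifs <;> omega

theorem largerCount_zero {s : Multiset ℕ} (h0 : 0 ∉ s) : largerCount s 0 = s.card :=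
  Multiset.countP_eq_card.2 fun a ha => Nat.pos_of_ne_zero (by rintro rfl; exact h0 ha)

theorem largerCount_sum (s : Multiset ℕ) : largerCount s s.sum = 0 :=
  Multiset.countP_eq_zero.2 fun _ ha => not_lt.2 (Multiset.le_sum_of_mem ha)

/-- The number of partitions of `n` for which some `w` is exceeded by exactly `w + r` parts. -/
noncomputable def holeCount (r n : ℕ) : ℕ :=
  partitionCount (fun s => ∃ w, largerCount s w = w + r) n

theorem largerCount_unique {s : Multiset ℕ} {r w w' : ℕ} (h : largerCount s w = w + r)
    (h' : largerCount s w' = w' + r) : w = w' := by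
  rcases lt_trichotomy w w' with hlt | heq | hlt
  · have := largerCount_antitone s hlt.le
    omega
  · exact heq
  · have := largerCount_antitone s hlt.le
    omega

theorem holeCount_eq_zero {r n : ℕ} (h : n < r) : holeCount r n = 0 := by
  refine partitionCount_eq_zero ?_
  rintro s h0 hs ⟨w, hw⟩
  have h1 := largerCount_antitone s (Nat.zero_le w)
  have h2 := card_le_sum_of_zero_notMem h0
  rw [largerCount_zero h0] at h1
  omega

/-- The number of parts exceeding `w` is lowered by one in each of them and `w` is inserted. -/
theorem partitionCount_largerCount_eq (w r n : ℕ) :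
    partitionCount (fun s => largerCount s w = w + r) (n + r) =
      partitionCount (fun s => largerCount s w ≤ w + r ∧
        (w = 0 ∨ w + r + 1 ≤ largerCount s (w - 1))) n := by
  refine partitionCount_eq_of_inverse
    -- The `w + r` lowered parts and the inserted `w` change the sum by `-r`. Zeros, which arise
    -- only for `w = 0`, are discarded.
    (fun t => ((t.filter (w < ·)).map Nat.pred + {w} + t.filter (· ≤ w)).filter (· ≠ 0))
    -- The large parts still missing are copies of `w` raised to `w + 1`; one further copy is the
    -- inserted part. For `w = 0` no copies are visible, and the truncated subtraction removes
    -- nothing.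
    (fun s => (s.filter (w < ·)).map Nat.succ +
      Multiset.replicate (w + r - largerCount s w) (w + 1) +
        (s.filter (· ≤ w) - Multiset.replicate (w + r - largerCount s w + 1) w)) ?_ ?_
  · intro t h0 ht hQ
    have hA : ∀ a ∈ t.filter (w < ·), w < a := fun a ha => (Multiset.mem_filter.1 ha).2
    have hA0 : 0 ∉ t.filter (w < ·) := fun h => h0 (Multiset.mem_filter.1 h).1
    have hL0 : 0 ∉ t.filter (· ≤ w) := fun h => h0 (Multiset.mem_filter.1 h).1
    have hsplit : t.filter (w < ·) + t.filter (· ≤ w) = t := by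
      simpa only [not_lt] using Multiset.filter_add_not (w < ·) t
    have hcard : (t.filter (w < ·)).card = w + r := by
      rw [← hQ, largerCount, Multiset.countP_eq_card_filter]
    have hpred := sum_map_pred_add_card hA0
    have hsum := congrArg Multiset.sum hsplit
    rw [Multiset.sum_add] at hsum
    have key := map_succ_filter_map_pred hA
    have key' := filter_le_map_pred hA
    have hLw : ∀ a ∈ t.filter (· ≤ w), a ≤ w := fun a ha => (Multiset.mem_filter.1 ha).2
    generalize t.filter (w < ·) = A at *
    generalize t.filter (· ≤ w) = L at *
    have hgt : ((A.map Nat.pred + {w} + L).filter (· ≠ 0)).filter (w < ·) =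
        (A.map Nat.pred).filter (w < ·) := by
      rw [Multiset.filter_filter, Multiset.filter_congr (q := (w < ·)) (fun a _ => by omega),
        Multiset.filter_add, Multiset.filter_add,
        Multiset.filter_eq_nil.2 (fun a ha => not_lt.2 (hLw a ha))]
      simp
    have hle : ((A.map Nat.pred + {w} + L).filter (· ≠ 0)).filter (· ≤ w) =
        (Multiset.replicate (A.count (w + 1) + 1) w).filter (· ≠ 0) + L := by
      rw [Multiset.filter_comm, Multiset.filter_add, Multiset.filter_add, Multiset.filter_add,
        key', Multiset.filter_eq_self.2 hLw, filter_ne_zero_of_zero_notMem hL0,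
        (Multiset.filter_eq_self (p := (· ≤ w)) (s := {w})).2 (by simp),
        add_comm _ ({w} : Multiset ℕ), Multiset.singleton_add, Multiset.replicate_succ]
    have hcount : largerCount ((A.map Nat.pred + {w} + L).filter (· ≠ 0)) w + A.count (w + 1) =
        w + r := by
      rw [largerCount, Multiset.countP_eq_card_filter, hgt, ← hcard]
      conv_rhs => rw [← key]
      simp
    refine ⟨by simp, ?_, ⟨by omega, ?_⟩, ?_⟩
    · rw [sum_filter_ne_zero, Multiset.sum_add, Multiset.sum_add, Multiset.sum_singleton]
      omega
    · rcases Nat.eq_zero_or_pos w with hw | hw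
      · exact Or.inl hw
      · right
        obtain ⟨v, rfl⟩ := Nat.exists_eq_succ_of_ne_zero hw.ne'
        have h1 := largerCount_eq_count_add ((A.map Nat.pred + {v + 1} + L).filter (· ≠ 0)) v
        have h2 : A.count (v + 1 + 1) + 1 ≤
            ((A.map Nat.pred + {v + 1} + L).filter (· ≠ 0)).count (v + 1) := by
          rw [Multiset.le_count_iff_replicate_le]
          refine le_trans ?_ (Multiset.filter_le (· ≤ v + 1) _)
          rw [hle, Multiset.filter_eq_self.2 (by simp +contextual [Multiset.mem_replicate])]
          exact Multiset.le_add_right _ _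
        simp only [Nat.succ_eq_add_one, Nat.add_sub_cancel] at *
        omega
    · rw [hgt, hle, show w + r - largerCount ((A.map Nat.pred + {w} + L).filter (· ≠ 0)) w =
        A.count (w + 1) by omega, key]
      rcases Nat.eq_zero_or_pos w with rfl | hw
      · have hL : L = 0 := Multiset.eq_zero_of_forall_notMem fun a ha => by
          have := hLw a ha
          obtain rfl : a = 0 := by omega
          exact hL0 ha
        rw [← hsplit, hL]
        congr 1
        rw [Multiset.filter_eq_nil.2 (by simp +contextual [Multiset.mem_replicate])]
        simp
      · rw [Multiset.filter_eq_self.2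
          (fun a ha => by rw [Multiset.eq_of_mem_replicate ha]; exact hw.ne'),
          add_tsub_cancel_left, hsplit]
  · intro s h0 hs hQ
    obtain ⟨hQ1, hQ2⟩ := hQ
    have hA0 : 0 ∉ s.filter (w < ·) := fun h => h0 (Multiset.mem_filter.1 h).1
    have hsplit : s.filter (w < ·) + s.filter (· ≤ w) = s := by
      simpa only [not_lt] using Multiset.filter_add_not (w < ·) s
    have hcard : (s.filter (w < ·)).card = largerCount s w := by
      rw [largerCount, Multiset.countP_eq_card_filter]
    have hAw : ∀ a ∈ s.filter (w < ·), w < a := fun a ha => (Multiset.mem_filter.1 ha).2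
    have hLw : ∀ a ∈ s.filter (· ≤ w), a ≤ w := fun a ha => (Multiset.mem_filter.1 ha).2
    have hL0 : 0 ∉ s.filter (· ≤ w) := fun h => h0 (Multiset.mem_filter.1 h).1
    obtain ⟨k, hk⟩ := Nat.exists_eq_add_of_le hQ1
    have hk' : w + r - largerCount s w = k := by omega
    obtain ⟨L, hL, hLL⟩ : ∃ L, s.filter (· ≤ w) - Multiset.replicate (k + 1) w = L ∧
        (s.filter (· ≤ w) = Multiset.replicate (k + 1) w + L ∨
          w = 0 ∧ s.filter (· ≤ w) = 0 ∧ L = 0) := by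
      refine ⟨_, rfl, ?_⟩
      rcases Nat.eq_zero_or_pos w with rfl | hw
      · right
        have hz : s.filter (· ≤ 0) = 0 := Multiset.eq_zero_of_forall_notMem fun a ha => by
          have := hLw a ha
          obtain rfl : a = 0 := by omega
          exact hL0 ha
        exact ⟨rfl, hz, by rw [hz]; simp⟩
      · left
        refine (add_tsub_cancel_of_le ?_).symm
        rw [← Multiset.le_count_iff_replicate_le,
          Multiset.count_filter_of_pos (p := (· ≤ w)) le_rfl]
        obtain ⟨v, rfl⟩ := Nat.exists_eq_succ_of_ne_zero hw.ne'
        have h1 := largerCount_eq_count_add s v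
        have h2 := hQ2.resolve_left hw.ne'
        simp only [Nat.succ_eq_add_one, Nat.add_sub_cancel] at *
        omega
    have hLle : ∀ a ∈ L, a ≤ w := by
      intro a ha
      rw [← hL] at ha
      exact hLw a (Multiset.mem_of_le tsub_le_self ha)
    have hL0' : 0 ∉ L := by
      intro h
      rw [← hL] at h
      exact hL0 (Multiset.mem_of_le tsub_le_self h)
    simp only [hk', hL]
    have hsum := congrArg Multiset.sum hsplit
    rw [Multiset.sum_add] at hsum
    have hLsum : (s.filter (· ≤ w)).sum = (k + 1) * w + L.sum := by
      rcases hLL with h | ⟨h1, h2, h3⟩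
      · rw [h, Multiset.sum_add, Multiset.sum_replicate, smul_eq_mul]
      · rw [h2, h3, h1]
        simp
    generalize s.filter (w < ·) = A at *
    have hgt : (A.map Nat.succ + Multiset.replicate k (w + 1) + L).filter (w < ·) =
        A.map Nat.succ + Multiset.replicate k (w + 1) := by
      rw [Multiset.filter_add, Multiset.filter_eq_nil.2 (fun a ha => not_lt.2 (hLle a ha)),
        add_zero, Multiset.filter_eq_self]
      intro a ha
      rw [Multiset.mem_add, Multiset.mem_map, Multiset.mem_replicate] at ha
      rcases ha with ⟨b, hb, rfl⟩ | ⟨-, rfl⟩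
      · have := hAw b hb
        omega
      · omega
    have hle : (A.map Nat.succ + Multiset.replicate k (w + 1) + L).filter (· ≤ w) = L := by
      rw [Multiset.filter_add, Multiset.filter_eq_self.2 hLle, add_eq_right,
        Multiset.filter_eq_nil]
      intro a ha
      rw [← hgt] at ha
      exact not_le.2 (Multiset.mem_filter.1 ha).2
    refine ⟨?_, ?_, ?_, ?_⟩
    · rw [Multiset.mem_add, Multiset.mem_add]
      simp [hL0', Multiset.mem_replicate]
    · rw [Multiset.sum_add, Multiset.sum_add, sum_map_succ, Multiset.sum_replicate, smul_eq_mul]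
      have e1 : k * (w + 1) = k * w + k := by ring
      have e2 : (k + 1) * w = k * w + w := by ring
      omega
    · rw [largerCount, Multiset.countP_eq_card_filter, hgt, Multiset.card_add, Multiset.card_map,
        Multiset.card_replicate]
      omega
    · rw [hgt, hle, Multiset.map_add, map_pred_map_succ, Multiset.map_replicate, Nat.pred_succ]
      rw [← hsplit]
      rcases hLL with h | ⟨h1, h2, h3⟩
      · rw [h, filter_ne_zero_of_zero_notMem, Multiset.replicate_succ, ← Multiset.singleton_add]
        · abel
        · rw [h, Multiset.replicate_succ, ← Multiset.singleton_add] at hL0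
          simp only [Multiset.mem_add, not_or] at hL0 ⊢
          exact ⟨⟨⟨hA0, hL0.1.2⟩, hL0.1.1⟩, hL0.2⟩
      · rw [h2, h3, h1, add_zero, add_zero, Multiset.filter_add, Multiset.filter_add,
          filter_ne_zero_of_zero_notMem hA0,
          Multiset.filter_eq_nil.2 (fun a ha => by rw [Multiset.eq_of_mem_replicate ha]; simp)]
        simp

/-- The decreasing `largerCount s v` and the increasing `v + r + 1` either meet or cross without
meeting. In the second case there is a unique first `w` past the crossing, and such partitions are
the images of the lowering bijection. -/
theorem holeCount_add (r n : ℕ) :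
    holeCount r (n + r) + holeCount (r + 1) n = Fintype.card (Nat.Partition n) := by
  rw [← partitionCount_add_not (fun s => ∃ w, largerCount s w = w + (r + 1)), add_comm]
  congr 1
  unfold holeCount
  rw [partitionCount_eq_sum (range (n + r + 1)) (fun w s => largerCount s w = w + r),
    partitionCount_eq_sum (range (n + r + 1)) (fun w s => largerCount s w ≤ w + r ∧
        (w = 0 ∨ w + r + 1 ≤ largerCount s (w - 1)))]
  · exact sum_congr rfl fun w _ => partitionCount_largerCount_eq w r n
  · intro s h0 hs
    constructor
    · intro hne
      have hex : ∃ w, largerCount s w ≤ w + r := by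
        refine ⟨s.sum, ?_⟩
        rw [largerCount_sum]
        exact Nat.zero_le _
      classical
      refine ⟨Nat.find hex, ?_, Nat.find_spec hex, ?_⟩
      · have : Nat.find hex ≤ s.sum := Nat.find_min' hex (by
          rw [largerCount_sum]
          exact Nat.zero_le _)
        rw [mem_range]
        omega
      · rcases Nat.eq_zero_or_pos (Nat.find hex) with h | h
        · exact Or.inl h
        · right
          have h1 := Nat.find_min hex (Nat.sub_lt h one_pos)
          have h2 : largerCount s (Nat.find hex - 1) ≠ (Nat.find hex - 1) + (r + 1) :=
            fun h => hne ⟨_, h⟩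
          omega
    · rintro ⟨w, -, h1, h2⟩ ⟨v, hv⟩
      rcases lt_or_ge v w with hvw | hvw
      · have := largerCount_antitone s (show v ≤ w - 1 by omega)
        omega
      · have := largerCount_antitone s hvw
        omega
  · rintro w w' s ⟨h1, h2⟩ ⟨h1', h2'⟩
    rcases lt_trichotomy w w' with hlt | heq | hlt
    · have := largerCount_antitone s (show w ≤ w' - 1 by omega)
      omega
    · exact heq
    · have := largerCount_antitone s (show w' ≤ w - 1 by omega)
      omega
  · intro s h0 hs
    constructor
    · rintro ⟨w, hw⟩
      refine ⟨w, ?_, hw⟩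
      have h1 := largerCount_antitone s (Nat.zero_le w)
      have h2 := card_le_sum_of_zero_notMem h0
      rw [largerCount_zero h0] at h1
      rw [mem_range]
      omega
    · rintro ⟨w, -, hw⟩
      exact ⟨w, hw⟩
  · exact fun w w' s => largerCount_unique

/-! ### Largest part and number of parts -/

theorem partitionCount_card_eq (k n : ℕ) :
    partitionCount (fun s => s.card = k) (n + k) = partitionCount (fun s => s.card ≤ k) n := by
  refine partitionCount_eq_of_inverse dropColumn (addColumn k) ?_ ?_
  · rintro s h0 hs rfl
    have := sum_dropColumn h0
    exact ⟨zero_notMem_dropColumn s, by omega, card_dropColumn_le s, addColumn_dropColumn h0⟩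
  · rintro s h0 hs hk
    exact ⟨zero_notMem_addColumn k s, by rw [sum_addColumn hk, hs], card_addColumn hk,
      dropColumn_addColumn k h0⟩

theorem partitionCount_sup_eq {k : ℕ} (hk : 0 < k) (n : ℕ) :
    partitionCount (fun s => s.sup = k) (n + k) = partitionCount (fun s => s.sup ≤ k) n := by
  refine partitionCount_eq_of_inverse (fun s => s.erase k) (fun s => k ::ₘ s) ?_ ?_
  · rintro s h0 hs rfl
    have hmem := sup_mem_of_ne_zero (s := s) (by rintro rfl; simp at hk)
    have := Multiset.sum_erase hmem
    exact ⟨fun h => h0 (Multiset.mem_of_mem_erase h), by omega,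
      Multiset.sup_mono fun a ha => Multiset.mem_of_mem_erase ha, Multiset.cons_erase hmem⟩
  · rintro s h0 hs hle
    refine ⟨?_, by rw [Multiset.sum_cons]; omega, ?_, Multiset.erase_cons_head k s⟩
    · rw [Multiset.mem_cons, not_or]
      exact ⟨hk.ne, h0⟩
    · rw [Multiset.sup_cons]
      exact sup_eq_left.2 hle

/-- Instead of conjugation: removing a largest part and removing the first column give the same
recursion. -/
theorem partitionCount_sup_eq_card (n : ℕ) : ∀ k, partitionCount (fun s => s.sup = k) n =
    partitionCount (fun s => s.card = k) n := by
  induction n using Nat.strong_induction_on with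
  | _ n ih =>
    intro k
    rcases Nat.eq_zero_or_pos k with rfl | hk
    · refine partitionCount_congr fun s h0 _ => ?_
      rw [Multiset.card_eq_zero]
      constructor
      · intro h
        by_contra hne
        exact h0 (h ▸ sup_mem_of_ne_zero hne)
      · rintro rfl
        simp
    · rcases lt_or_ge n k with hlt | hle
      · rw [partitionCount_eq_zero, partitionCount_eq_zero]
        · intro s h0 hs h
          have := card_le_sum_of_zero_notMem h0
          omega
        · intro s h0 hs h
          have := sup_le_sum s
          omega
      · obtain ⟨m, rfl⟩ := Nat.exists_eq_add_of_le' hle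
        rw [partitionCount_sup_eq hk, partitionCount_card_eq,
          partitionCount_eq_sum (range (k + 1)) (fun i s => s.sup = i),
          partitionCount_eq_sum (range (k + 1)) (fun i s => s.card = i)]
        · exact sum_congr rfl fun i _ => ih m (by omega) i
        all_goals
          intros
          first
          | omega
          | simp

/-- Partitions with largest part at least `r` are as many as those with at least `r` parts. -/
theorem partitionCount_le_sup (r n : ℕ) :
    partitionCount (fun s => r ≤ s.sup) n = partitionCount (fun s => r ≤ s.card) n := by
  rw [partitionCount_eq_sum (Icc r n) (fun i s => s.sup = i),
    partitionCount_eq_sum (Icc r n) (fun i s => s.card = i)]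
  · exact sum_congr rfl fun i _ => partitionCount_sup_eq_card n i
  · intro s h0 hs
    have := card_le_sum_of_zero_notMem h0
    simp only [mem_Icc]
    exact ⟨fun h => ⟨_, ⟨h, by omega⟩, rfl⟩, fun ⟨w, h, h'⟩ => by omega⟩
  · exact fun w w' s h h' => h.symm.trans h'
  · intro s h0 hs
    have := sup_le_sum s
    simp only [mem_Icc]
    exact ⟨fun h => ⟨_, ⟨h, by omega⟩, rfl⟩, fun ⟨w, h, h'⟩ => by omega⟩
  · exact fun _ _ _ h₁ h₂ => h₁.symm.trans h₂

/-- Removing a part equal to one. -/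
theorem partitionCount_erase_one {Q Q' : Multiset ℕ → Prop} {n : ℕ}
    (h : ∀ s : Multiset ℕ, 0 ∉ s → s.sum = n → (Q (1 ::ₘ s) ↔ Q' s)) :
    partitionCount (fun s => Q s ∧ ¬ s.count 1 = 0) (n + 1) = partitionCount Q' n := by
  refine partitionCount_eq_of_inverse (fun s => s.erase 1) (fun s => 1 ::ₘ s) ?_ ?_
  · rintro s h0 hs ⟨hQ, h1⟩
    have hmem : 1 ∈ s := Multiset.count_ne_zero.1 h1
    have hsum := Multiset.sum_erase hmem
    have h0' : 0 ∉ s.erase 1 := fun h => h0 (Multiset.mem_of_mem_erase h)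
    refine ⟨h0', by omega, ?_, Multiset.cons_erase hmem⟩
    rw [← h _ h0' (by omega), Multiset.cons_erase hmem]
    exact hQ
  · rintro s h0 hs hQ
    refine ⟨?_, by rw [Multiset.sum_cons]; omega, ⟨(h s h0 hs).2 hQ, ?_⟩,
      Multiset.erase_cons_head 1 s⟩
    · rw [Multiset.mem_cons, not_or]
      exact ⟨by omega, h0⟩
    · simp

/-- Among all partitions, `r ≤ s.sup` and `r ≤ s.card` are equally frequent. Among those containing
a one, removing it keeps the largest part and lowers the number of parts; subtract. The partition of
1 is the exception, as nothing remains of it. -/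
theorem partitionCount_le_sup_without_ones {r n : ℕ} (hr : 0 < r) (hn : n ≠ 1) :
    partitionCount (fun s => r ≤ s.sup ∧ s.count 1 = 0) n =
      partitionCount (fun s => r + 1 ≤ s.card ∧ s.count 1 = 0) n +
        partitionCount (fun s => s.card = r) n := by
  have h1 := partitionCount_and_add_and_not (fun s => r ≤ s.sup) (fun s => s.count 1 = 0) n
  have h2 := partitionCount_and_add_and_not (fun s => r + 1 ≤ s.card) (fun s => s.count 1 = 0) n
  have h3 := partitionCount_and_add_and_not (fun s => r ≤ s.card) (fun s => s.card = r) n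
  rw [partitionCount_congr (Q := fun s => r ≤ s.card ∧ s.card = r) (Q' := fun s => s.card = r)
    (fun s _ _ => by omega), partitionCount_congr (Q := fun s => r ≤ s.card ∧ ¬ s.card = r)
    (Q' := fun s => r + 1 ≤ s.card) (fun s _ _ => by omega)] at h3
  have h4 := partitionCount_le_sup r n
  have h5 : partitionCount (fun s => r ≤ s.sup ∧ ¬ s.count 1 = 0) n =
      partitionCount (fun s => r + 1 ≤ s.card ∧ ¬ s.count 1 = 0) n := by
    rcases Nat.eq_zero_or_pos n with rfl | hn0
    · rw [partitionCount_eq_zero, partitionCount_eq_zero]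
      · rintro s h0 hs ⟨h, -⟩
        have := card_le_sum_of_zero_notMem h0
        omega
      · rintro s h0 hs ⟨h, -⟩
        have := sup_le_sum s
        omega
    · obtain ⟨m, rfl⟩ := Nat.exists_eq_add_of_le' hn0
      rw [partitionCount_erase_one (Q' := fun s => r ≤ s.sup),
        partitionCount_erase_one (Q' := fun s => r ≤ s.card), partitionCount_le_sup]
      · intro s _ _
        rw [Multiset.card_cons]
        omega
      · intro s h0 hs
        have hne : s ≠ 0 := by
          rintro rfl
          simp at hs
          omega
        have hpos : 1 ≤ s.sup := by
          rw [Nat.one_le_iff_ne_zero]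
          exact fun h => h0 (h ▸ sup_mem_of_ne_zero hne)
        rw [Multiset.sup_cons, sup_eq_right.2 hpos]
  omega

/-! ### The crank -/

theorem largerCount_add_replicate (u : Multiset ℕ) (j a w : ℕ) :
    largerCount (u + Multiset.replicate j a) w = largerCount u w + if w < a then j else 0 := by
  unfold largerCount
  rw [Multiset.countP_add]
  split_ifs with h
  · rw [(Multiset.countP_eq_card (s := Multiset.replicate j a)).2
      fun b hb => (Multiset.eq_of_mem_replicate hb).symm ▸ h, Multiset.card_replicate]
  · rw [(Multiset.countP_eq_zero (s := Multiset.replicate j a)).2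
      fun b hb => (Multiset.eq_of_mem_replicate hb).symm ▸ h]

/-- The surplus of parts exceeding `w` is taken from the parts `w + 1`, which are split
into ones. -/
theorem partitionCount_split_into_ones {w : ℕ} (hw : 0 < w) (r n : ℕ) :
    partitionCount (fun s => s.count 1 ≤ w ∧ w + r ≤ largerCount s w ∧
      largerCount s (w + 1) < w + 1 + r) n =
    partitionCount (fun s => largerCount s w = w + r) n := by
  have hw1 : w + 1 ≠ 1 := by omega
  refine partitionCount_eq_of_inverse
    (fun s => s - Multiset.replicate (largerCount s w - (w + r)) (w + 1) +
      Multiset.replicate ((largerCount s w - (w + r)) * (w + 1)) 1)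
    (fun t => t - Multiset.replicate (t.count 1 / (w + 1) * (w + 1)) 1 +
      Multiset.replicate (t.count 1 / (w + 1)) (w + 1)) ?_ ?_
  · rintro s h0 hs ⟨h1, h2, h3⟩
    obtain ⟨j, hj⟩ : ∃ j, largerCount s w - (w + r) = j := ⟨_, rfl⟩
    have hcount := largerCount_eq_count_add s w
    obtain ⟨u, rfl⟩ : ∃ u, s = u + Multiset.replicate j (w + 1) := by
      refine ⟨s - Multiset.replicate j (w + 1), (tsub_add_cancel_of_le ?_).symm⟩
      rw [← Multiset.le_count_iff_replicate_le]
      omega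
    simp only [hj, add_tsub_cancel_right]
    -- There were at most `w` ones before, so division by `w + 1` recovers the number of split
    -- parts.
    have hu1 : (u + Multiset.replicate (j * (w + 1)) 1).count 1 / (w + 1) = j := by
      rw [Multiset.count_add, Multiset.count_replicate_self]
      rw [Multiset.count_add, Multiset.count_replicate, if_neg hw1] at h1
      rw [Nat.add_mul_div_right _ _ (by omega), Nat.div_eq_of_lt (by omega), zero_add]
    refine ⟨?_, ?_, ?_, ?_⟩
    · rw [Multiset.mem_add, not_or] at h0 ⊢
      exact ⟨h0.1, by simp [Multiset.mem_replicate]⟩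
    · rw [← hs]
      simp
    · rw [largerCount_add_replicate] at hj h2 ⊢
      rw [if_pos (by omega)] at hj h2
      rw [if_neg (by omega)]
      omega
    · rw [hu1, add_tsub_cancel_right]
  · rintro t h0 ht hQ
    obtain ⟨j, hj⟩ : ∃ j, t.count 1 / (w + 1) = j := ⟨_, rfl⟩
    have hdm := Nat.div_add_mod (t.count 1) (w + 1)
    have hmod := Nat.mod_lt (t.count 1) (show 0 < w + 1 by omega)
    rw [hj] at hdm
    obtain ⟨u, rfl⟩ : ∃ u, t = u + Multiset.replicate (j * (w + 1)) 1 := by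
      refine ⟨t - Multiset.replicate (j * (w + 1)) 1, (tsub_add_cancel_of_le ?_).symm⟩
      rw [← Multiset.le_count_iff_replicate_le, mul_comm]
      omega
    simp only [hj, add_tsub_cancel_right]
    have hu : largerCount u w = w + r := by
      rw [largerCount_add_replicate, if_neg (by omega)] at hQ
      exact hQ
    have hl : largerCount (u + Multiset.replicate j (w + 1)) w = w + r + j := by
      rw [largerCount_add_replicate, if_pos (by omega), hu]
    refine ⟨?_, ?_, ⟨?_, by omega, ?_⟩, ?_⟩
    · rw [Multiset.mem_add, not_or] at h0 ⊢
      exact ⟨h0.1, by simp [Multiset.mem_replicate]⟩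
    · rw [← ht]
      simp
    · rw [Multiset.count_add, Multiset.count_replicate_self, mul_comm (w + 1) j] at hdm
      rw [Multiset.count_add, Multiset.count_replicate_self] at hmod
      rw [Multiset.count_add, Multiset.count_replicate, if_neg hw1]
      omega
    · have h2 := largerCount_antitone u (show w ≤ w + 1 by omega)
      rw [largerCount_add_replicate, if_neg (by omega)]
      omega
    · rw [hl, show w + r + j - (w + r) = j by omega, add_tsub_cancel_right]

/-- Both sides are sorted by a unique `w`: on the left the last one with `w + r ≤ largerCount s w`,
on the right the one with equality. Splitting surplus parts into ones matches them. -/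
theorem partitionCount_le_largerCount {r : ℕ} (hr : 0 < r) (n : ℕ) :
    partitionCount (fun s => max (s.count 1) 1 + r ≤ largerCount s (max (s.count 1) 1)) n =
      partitionCount (fun s => ∃ w, 0 < w ∧ largerCount s w = w + r) n := by
  have hbound : ∀ s : Multiset ℕ, 0 ∉ s → s.sum = n → ∀ w, w + r ≤ largerCount s w → w < n := by
    intro s h0 hs w hw
    have h1 := largerCount_antitone s (Nat.zero_le w)
    have h2 := card_le_sum_of_zero_notMem h0
    rw [largerCount_zero h0] at h1
    omega
  rw [partitionCount_eq_sum (Icc 1 n) (fun w s => s.count 1 ≤ w ∧ w + r ≤ largerCount s w ∧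
      largerCount s (w + 1) < w + 1 + r),
    partitionCount_eq_sum (Icc 1 n) (fun w s => largerCount s w = w + r)]
  · refine sum_congr rfl fun w hw => ?_
    exact partitionCount_split_into_ones (mem_Icc.1 hw).1 r n
  · intro s h0 hs
    constructor
    · rintro ⟨w, hw, h⟩
      exact ⟨w, mem_Icc.2 ⟨hw, (hbound s h0 hs w h.ge).le⟩, h⟩
    · rintro ⟨w, hw, h⟩
      exact ⟨w, (mem_Icc.1 hw).1, h⟩
  · exact fun w w' s => largerCount_unique
  · intro s h0 hs
    constructor
    · intro h
      have hex : ∃ w, max (s.count 1) 1 ≤ w ∧ largerCount s (w + 1) < w + 1 + r := by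
        refine ⟨max (max (s.count 1) 1) n, le_max_left _ _, ?_⟩
        by_contra hlt
        have := hbound s h0 hs _ (not_lt.1 hlt)
        omega
      classical
      obtain ⟨hw1, hw2⟩ := Nat.find_spec hex
      have hw3 : Nat.find hex + r ≤ largerCount s (Nat.find hex) := by
        rcases hw1.eq_or_lt with heq | hlt
        · rw [← heq]
          exact h
        · have h1 := Nat.find_min hex (Nat.sub_lt (by omega) one_pos : Nat.find hex - 1 < _)
          rw [not_and, not_lt] at h1
          have h2 := h1 (by omega)
          rw [Nat.sub_add_cancel (by omega)] at h2
          exact h2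
      exact ⟨Nat.find hex, mem_Icc.2 ⟨by omega, (hbound s h0 hs _ hw3).le⟩, by omega, hw3, hw2⟩
    · rintro ⟨w, hw, h1, h2, -⟩
      have := (mem_Icc.1 hw).1
      have := largerCount_antitone s (show max (s.count 1) 1 ≤ w by omega)
      omega
  · rintro w w' s ⟨-, h2, h3⟩ ⟨-, h2', h3'⟩
    rcases lt_trichotomy w w' with hlt | heq | hlt
    · have := largerCount_antitone s (show w + 1 ≤ w' by omega)
      omega
    · exact heq
    · have := largerCount_antitone s (show w' + 1 ≤ w by omega)
      omega

/-- The number of partitions with crank at least `r`. -/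
theorem partitionCount_crank_ge {r n : ℕ} (hr : 0 < r) (hn : n ≠ 1) :
    partitionCount (fun s => r ≤ s.sup ∧ s.count 1 = 0) n +
        partitionCount (fun s => s.count 1 + r ≤ largerCount s (s.count 1) ∧ ¬ s.count 1 = 0) n =
      holeCount r n := by
  -- Equality at `w = 0` means exactly `r` parts; this is the extra term of
  -- `partitionCount_le_sup_without_ones`.
  have h1 := partitionCount_and_add_and_not (fun s => ∃ w, largerCount s w = w + r)
    (fun s => s.card = r) n
  rw [partitionCount_congr (Q := fun s => (∃ w, largerCount s w = w + r) ∧ s.card = r)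
    (Q' := fun s => s.card = r), partitionCount_congr
    (Q := fun s => (∃ w, largerCount s w = w + r) ∧ ¬ s.card = r)
    (Q' := fun s => ∃ w, 0 < w ∧ largerCount s w = w + r),
    ← partitionCount_le_largerCount hr] at h1
  · have h2 := partitionCount_and_add_and_not
      (fun s => max (s.count 1) 1 + r ≤ largerCount s (max (s.count 1) 1))
      (fun s => s.count 1 = 0) n
    rw [partitionCount_congr (Q' := fun s => r + 1 ≤ s.card ∧ s.count 1 = 0), partitionCount_congr
      (Q := fun s => max (s.count 1) 1 + r ≤ largerCount s (max (s.count 1) 1) ∧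
        ¬ s.count 1 = 0)
      (Q' := fun s => s.count 1 + r ≤ largerCount s (s.count 1) ∧ ¬ s.count 1 = 0)] at h2
    · rw [partitionCount_le_sup_without_ones hr hn, holeCount]
      omega
    · intro s h0 hs
      refine and_congr_left fun h => ?_
      rw [max_eq_left (by omega)]
    · intro s h0 hs
      refine and_congr_left fun h => ?_
      -- Without ones every part exceeds 1, so the condition at `max 0 1 = 1` is about the number of
      -- parts.
      have := largerCount_eq_count_add s 0
      rw [largerCount_zero h0, zero_add, h, zero_add] at this
      rw [h, max_eq_right (by omega), ← this, add_comm]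
  · intro s h0 hs
    constructor
    · rintro ⟨⟨w, hw⟩, hc⟩
      refine ⟨w, Nat.pos_of_ne_zero ?_, hw⟩
      rintro rfl
      rw [largerCount_zero h0] at hw
      omega
    · rintro ⟨w, hw0, hw⟩
      refine ⟨⟨w, hw⟩, fun hc => ?_⟩
      have := largerCount_antitone s (Nat.zero_le w)
      rw [largerCount_zero h0] at this
      omega
  · intro s h0 hs
    refine and_iff_right_of_imp fun h => ⟨0, ?_⟩
    rw [largerCount_zero h0, h, zero_add]

/-! ### From moments to counts of partitions with large rank or crank -/

theorem sum_filter_card_eq {n r : ℕ} (f : Nat.Partition n → ℤ) (hf : ∀ p, f p ≤ n) :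
    ∑ m ∈ Icc r n, ((#{p | f p = (m : ℤ)} : ℕ) : ℤ) = #{p | (r : ℤ) ≤ f p} := by
  rw [← Nat.cast_sum, ← card_biUnion]
  · congr 2
    ext p
    simp only [mem_biUnion, mem_filter, mem_univ, true_and, mem_Icc]
    constructor
    · rintro ⟨m, hm, h⟩
      omega
    · intro h
      have := hf p
      exact ⟨(f p).toNat, by omega, by omega⟩
  · intro m _ m' _ hne
    refine disjoint_filter.2 fun p _ h h' => hne ?_
    exact_mod_cast h.symm.trans h'

theorem card_filter_eq_partitionCount {n : ℕ} (P : Nat.Partition n → Prop) [DecidablePred P]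
    (Q : Multiset ℕ → Prop) (h : ∀ p, P p ↔ Q p.parts) : #{p | P p} = partitionCount Q n := by
  classical
  unfold partitionCount
  simp only [h]

theorem sum_rankCount {r : ℕ} (n : ℕ) : ∑ m ∈ Icc r n, rankCount m n = rankGE r n := by
  simp only [rankCount, sum_filter_card_eq rank rank_le]
  rw [card_filter_eq_partitionCount _ (fun s => s.card + r ≤ s.sup), rankGE]
  intro p
  rw [rank, largestPart]
  omega

theorem sum_crankCount {r : ℕ} (hr : 0 < r) (n : ℕ) :
    ∑ m ∈ Icc r n, crankCount m n = holeCount r n := by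
  rcases eq_or_ne n 1 with rfl | hn
  -- The conventional value `M(1, 1) = 1` agrees with `holeCount 1 1`, so the formula needs no
  -- exception.
  · rcases eq_or_ne r 1 with rfl | hr1
    · have hall : partitionCount (fun s => ∃ w, largerCount s w = w + 1) 1 =
          partitionCount (fun _ => True) 1 := by
        refine partitionCount_congr fun s h0 hs => iff_true_intro ⟨0, ?_⟩
        have h1 := card_le_sum_of_zero_notMem h0
        have h2 : s.card ≠ 0 := by
          intro h
          rw [Multiset.card_eq_zero.1 h] at hs
          simp at hs
        rw [largerCount_zero h0]
        omega
      rw [holeCount, hall]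
      simp [crankCount, partitionCount]
    · rw [Icc_eq_empty (by omega), sum_empty, holeCount_eq_zero (by omega)]
      rfl
  · rw [← partitionCount_crank_ge hr hn]
    simp only [crankCount, if_neg hn, sum_filter_card_eq crank crank_le]
    rw [← card_filter_add_card_filter_not (fun p : Nat.Partition n => p.parts.count 1 = 0)]
    rw [filter_filter, filter_filter, card_filter_eq_partitionCount _
      (fun s => r ≤ s.sup ∧ s.count 1 = 0), card_filter_eq_partitionCount _
      (fun s => s.count 1 + r ≤ largerCount s (s.count 1) ∧ ¬ s.count 1 = 0)]
    · intro p
      refine and_congr_left fun h => ?_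
      rw [crank, numOnes, if_neg h, numLarge, numOnes, largerCount]
      omega
    · intro p
      refine and_congr_left fun h => ?_
      rw [crank, numOnes, if_pos h, largestPart]
      omega

theorem sum_mul_eq_sum_sum (f : ℤ → ℤ) (N : ℕ) :
    ∑ m ∈ Icc 1 N, (m : ℤ) ^ 1 * f m = ∑ r ∈ Icc 1 N, ∑ m ∈ Icc r N, f m := by
  rw [sum_comm' (t' := Icc 1 N) (s' := fun m => Icc 1 m)]
  · simp
  · intro r m
    simp only [mem_Icc]
    omega

theorem ospt_eq_sum (N : ℕ) :
    ospt N = ∑ r ∈ Icc 1 N, ((holeCount r N : ℤ) - rankGE r N) := by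
  rw [ospt, posCrankMoment, posRankMoment, sum_mul_eq_sum_sum (fun m => crankCount m N),
    sum_mul_eq_sum_sum (fun m => rankCount m N), ← sum_sub_distrib]
  refine sum_congr rfl fun r hr => ?_
  rw [sum_crankCount (mem_Icc.1 hr).1, sum_rankCount]

open PowerSeries

/-! ### The inverse of the Euler product -/

open PowerSeries.WithPiTopology in
theorem pentagonalSeries_mul_mk_card_partition (R : Type*) [CommRing R] :
    pentagonalSeries R * PowerSeries.mk (fun n => (Fintype.card (Nat.Partition n) : R)) = 1 := by
  let _ : TopologicalSpace R := ⊥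
  have _ : DiscreteTopology R := ⟨rfl⟩
  have h1 := hasProd_one_sub_X_pow R
  have h2 := Nat.Partition.hasProd_powerSeriesMk_card_restricted R (fun _ => True)
  have h3 := h1.mul h2
  have hone : ∀ i : ℕ, ((1 : R⟦X⟧) - X ^ (i + 1)) *
      (if True then ∑' j : ℕ, (X : R⟦X⟧) ^ ((i + 1) * j) else 1) = 1 := by
    intro i
    rw [if_pos trivial]
    simp_rw [pow_mul]
    exact one_sub_mul_tsum_pow_of_constantCoeff_eq_zero (by simp)
  simp only [hone] at h3
  have h4 := h3.unique hasProd_one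
  simpa [Nat.Partition.restricted] using h4

/-- For the pentagonal number `i` of index `k`, `24 * i + 1 = (6 * k - 1) ^ 2`; the signs vanish
modulo two. -/
theorem coeff_pentagonalSeries_two (i : ℕ) :
    coeff i (pentagonalSeries (ZMod 2)) = if IsSquare (24 * i + 1) then 1 else 0 := by
  split_ifs with h
  · obtain ⟨x, hx⟩ := h
    have hx2 : ¬ 2 ∣ x := fun h => by
      have : 2 ∣ x * x := h.mul_right x
      omega
    have hx3 : ¬ 3 ∣ x := fun h => by
      have : 3 ∣ x * x := h.mul_right x
      omega
    have hx' : (24 * i + 1 : ℤ) = x * x := by exact_mod_cast hx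
    obtain ⟨k, hk⟩ : ∃ k : ℤ, (6 * k - 1) * (6 * k - 1) = x * x := by
      have : x % 6 = 1 ∨ x % 6 = 5 := by omega
      rcases this with h | h
      · refine ⟨(1 - x) / 6, ?_⟩
        rw [show 6 * ((1 - (x : ℤ)) / 6) - 1 = -x by omega]
        ring
      · refine ⟨(x + 1) / 6, ?_⟩
        rw [show 6 * (((x : ℤ) + 1) / 6) - 1 = x by omega]
    have hik : i = pentagonal k := by
      zify
      have := two_mul_natCast_pentagonal k
      linarith
    rw [hik, coeff_pentagonalSeries_pentagonal]
    rcases Int.units_eq_one_or k.negOnePow with h | h <;> rw [h] <;> simp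
  · refine coeff_pentagonalSeries_eq_zero _ ?_
    rintro ⟨k, rfl⟩
    refine h ⟨(6 * k - 1).natAbs, ?_⟩
    zify
    rw [abs_mul_abs_self]
    have := two_mul_natCast_pentagonal k
    linarith

/-- The term `n = 0` is harmless: truncation makes `24 * 0 - 1 = 0`, which has no factorizations in
`Nat.divisorsAntidiagonal`. -/
theorem coeff_pentagonalSeries_mul_smallDivisorCount (M : ℕ) :
    coeff M (pentagonalSeries (ZMod 2) *
      PowerSeries.mk fun n => (smallDivisorCount (24 * n - 1) : ZMod 2)) = #(triples M) := by
  simp only [coeff_mul, coeff_pentagonalSeries_two, coeff_mk, ite_mul, one_mul, zero_mul]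
  rw [← sum_filter, ← Nat.cast_sum]
  simp only [smallDivisorCount]
  rw [← card_sigma]
  congr 1
  refine card_bij (fun y _ => (Nat.sqrt (24 * y.1.1 + 1), y.2.1, y.2.2)) ?_ ?_ ?_
  · rintro ⟨⟨i, j⟩, d, e⟩ hy
    simp only [mem_sigma, mem_filter, HasAntidiagonal.mem_antidiagonal,
      Nat.mem_divisorsAntidiagonal] at hy
    obtain ⟨⟨hij, x, hx⟩, ⟨hde, hj⟩, hlt⟩ := hy
    simp only [hx, Nat.sqrt_eq, mem_triples]
    refine ⟨?_, ?_, hlt, ?_, ?_⟩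
    · rw [sq, ← hx, hde]
      omega
    · refine Nat.pos_of_ne_zero ?_
      rintro rfl
      omega
    · intro h
      have : 2 ∣ x * x := h.mul_right x
      omega
    · intro h
      have : 3 ∣ x * x := h.mul_right x
      omega
  · rintro ⟨⟨i, j⟩, d, e⟩ hy ⟨⟨i', j'⟩, d', e'⟩ hy' heq
    simp only [mem_sigma, mem_filter, HasAntidiagonal.mem_antidiagonal,
      Nat.mem_divisorsAntidiagonal] at hy hy'
    obtain ⟨⟨hij, x, hx⟩, -, -⟩ := hy
    obtain ⟨⟨hij', x', hx'⟩, -, -⟩ := hy'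
    simp only [hx, hx', Nat.sqrt_eq, Prod.mk.injEq] at heq
    obtain ⟨rfl, rfl, rfl⟩ := heq
    obtain rfl : i = i' := by omega
    obtain rfl : j = j' := by omega
    rfl
  · rintro ⟨x, d, e⟩ ht
    rw [mem_triples] at ht
    obtain ⟨h, hd, hlt, h2, h3⟩ := ht
    have hx := sq_mod_of_coprime h2 h3
    have hx1 : 24 * (x ^ 2 / 24) + 1 = x * x := by
      rw [← sq]
      omega
    have hde : 0 < d * e := Nat.mul_pos hd (hd.trans hlt)
    refine ⟨⟨(x ^ 2 / 24, M - x ^ 2 / 24), (d, e)⟩, ?_, ?_⟩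
    · simp only [mem_sigma, mem_filter, HasAntidiagonal.mem_antidiagonal,
        Nat.mem_divisorsAntidiagonal]
      exact ⟨⟨by omega, x, hx1⟩, ⟨by omega, by omega⟩, hlt⟩
    · simp only [hx1, Nat.sqrt_eq]

/-! ### The generating functions of the rank and the crank -/

-- Iteration gives the sum over `k` of `X ^ ((k + 1) * (r + e) + d * k * (k + 1) / 2)`. The
-- exponents strictly increase, so each coefficient is 0 or 1; doubling them avoids the fraction.
open Classical in
theorem coeff_of_recurrence {d e : ℕ} (c : ℕ → (ZMod 2)⟦X⟧)
    (hc : ∀ r, 0 < r → c r = X ^ (r + e) * (1 + c (r + d))) (N : ℕ) : ∀ r, 0 < r →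
    coeff N (c r) =
      if ∃ k, 2 * (k + 1) * (r + e) + d * (k + 1) * k = 2 * N then 1 else 0 := by
  induction N using Nat.strong_induction_on with
  | _ N ih =>
    intro r hr
    rw [hc r hr, coeff_X_pow_mul']
    split_ifs with h1 h2 h2
    · obtain ⟨m, rfl⟩ := Nat.exists_eq_add_of_le' h1
      rw [Nat.add_sub_cancel, map_add, ih m (by omega) _ (by omega), coeff_one]
      obtain ⟨k, hk⟩ := h2
      rcases k with _ | k
      · have hm : m = 0 := by linarith
        subst hm
        rw [if_pos rfl, if_neg, add_zero]
        rintro ⟨k, hk⟩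
        have : 0 < 2 * (k + 1) * (r + d + e) := by positivity
        omega
      · have hk' : 2 * (k + 1) * (r + d + e) + d * (k + 1) * k = 2 * m := by
          linarith
        have hm : m ≠ 0 := by
          rintro rfl
          have : 0 < 2 * (k + 1) * (r + d + e) := by positivity
          omega
        rw [if_neg hm, if_pos ⟨k, hk'⟩, zero_add]
    · obtain ⟨m, rfl⟩ := Nat.exists_eq_add_of_le' h1
      rw [Nat.add_sub_cancel, map_add, ih m (by omega) _ (by omega), coeff_one, if_neg, if_neg,
        add_zero]
      · rintro ⟨k, hk⟩
        exact h2 ⟨k + 1, by linarith⟩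
      · rintro rfl
        exact h2 ⟨0, by linarith⟩
    · obtain ⟨k, hk⟩ := h2
      have : r + e ≤ (k + 1) * (r + e) := Nat.le_mul_of_pos_left _ (by omega)
      have : 2 * ((k + 1) * (r + e)) + d * (k + 1) * k = 2 * N := by rw [← hk]; ring
      omega
    · rfl

-- Put `a = k + 1` and `b = 2 * (r + e) + (2 * e + 1) * k`; then `b - (2 * e + 1) * a = 2 * r - 1`.
-- For fixed `r` this makes `b` grow with `a`, so the product determines the pair.
open Classical in
theorem card_recurrence_solutions (e N : ℕ) :
    #{r ∈ Icc 1 N | ∃ k, 2 * (k + 1) * (r + e) + (2 * e + 1) * (k + 1) * k = 2 * N} =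
      #{x ∈ oppositeFactors (2 * N) | (2 * e + 1) * x.1 < x.2} := by
  symm
  refine card_bij (fun x _ => (x.2 + 1 - (2 * e + 1) * x.1) / 2) ?_ ?_ ?_
  · rintro ⟨a, b⟩ hx
    simp only [mem_filter, mem_oppositeFactors] at hx
    obtain ⟨⟨⟨hab, hN⟩, hodd⟩, hlt⟩ := hx
    have ha : a ≠ 0 := by
      rintro rfl
      omega
    obtain ⟨k, rfl⟩ := Nat.exists_eq_succ_of_ne_zero ha
    have hb : b ≤ 2 * N := by
      rw [← hab]
      exact Nat.le_mul_of_pos_left _ (by omega)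
    rw [Nat.odd_iff] at hodd
    simp only [Nat.succ_eq_add_one] at *
    have hexp : (2 * e + 1) * (k + 1) = 2 * (e * (k + 1)) + (k + 1) := by ring
    obtain ⟨r, hr⟩ : ∃ r, b + 1 = 2 * r + (2 * e + 1) * (k + 1) :=
      ⟨(b + 1 - (2 * e + 1) * (k + 1)) / 2, by omega⟩
    rw [hr, Nat.add_sub_cancel, Nat.mul_div_cancel_left _ two_pos]
    rw [mem_filter, mem_Icc]
    refine ⟨⟨by omega, by omega⟩, k, ?_⟩
    have hb' : b = 2 * (r + e) + (2 * e + 1) * k := by linarith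
    rw [← hab, hb']
    ring
  · rintro ⟨a, b⟩ hx ⟨a', b'⟩ hx' heq
    simp only [mem_filter, mem_oppositeFactors] at hx hx'
    obtain ⟨⟨⟨hab, hN⟩, hodd⟩, hlt⟩ := hx
    obtain ⟨⟨⟨hab', -⟩, hodd'⟩, hlt'⟩ := hx'
    rw [Nat.odd_iff] at hodd hodd'
    have hexp : ∀ a, (2 * e + 1) * a = 2 * (e * a) + a := fun a => by ring
    have h1 := hexp a
    have h2 := hexp a'
    have hdiff : b + (2 * e + 1) * a' = b' + (2 * e + 1) * a := by
      simp only at heq hlt hlt'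
      omega
    rcases lt_trichotomy a a' with h | rfl | h
    · have : b' < b := by
        by_contra hle
        have : (2 * e + 1) * a < (2 * e + 1) * a' := Nat.mul_lt_mul_of_pos_left h (by omega)
        have hbb : a * b < a' * b' := Nat.mul_lt_mul_of_lt_of_le h (not_lt.1 hle) (by omega)
        omega
      have : (2 * e + 1) * a < (2 * e + 1) * a' := Nat.mul_lt_mul_of_pos_left h (by omega)
      omega
    · rw [Prod.mk.injEq]
      omega
    · have : (2 * e + 1) * a' < (2 * e + 1) * a := Nat.mul_lt_mul_of_pos_left h (by omega)
      have : b' > b := by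
        by_contra hle
        have hbb : a' * b' < a * b := Nat.mul_lt_mul_of_lt_of_le h (not_lt.1 hle) (by omega)
        omega
      omega
  · intro r hr
    rw [mem_filter, mem_Icc] at hr
    obtain ⟨⟨hr1, hrN⟩, k, hk⟩ := hr
    have hexp : (2 * e + 1) * k = 2 * (e * k) + k := by ring
    have hexp' : (2 * e + 1) * (k + 1) = (2 * e + 1) * k + (2 * e + 1) := by ring
    refine ⟨(k + 1, 2 * (r + e) + (2 * e + 1) * k), ?_, ?_⟩
    · rw [mem_filter, mem_oppositeFactors, Nat.odd_iff]
      refine ⟨⟨⟨?_, by omega⟩, ?_⟩, ?_⟩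
      · rw [← hk]
        ring
      · dsimp only
        omega
      · dsimp only
        omega
    · dsimp only
      omega

/-- The Euler product turns the partition numbers in `hadd` into the constant series 1, and modulo
two the subtraction becomes an addition. -/
theorem coeff_pentagonalSeries_mul_of_recurrence {e : ℕ} (u : ℕ → ℕ → ℕ)
    (h0 : ∀ r n, 0 < r → n < r + e → u r n = 0)
    (hadd : ∀ r n, u r (n + (r + e)) + u (r + (2 * e + 1)) n = Fintype.card (Nat.Partition n))
    (N : ℕ) :
    ∑ r ∈ Icc 1 N, coeff N (pentagonalSeries (ZMod 2) * PowerSeries.mk fun n => (u r n : ZMod 2)) =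
      #{x ∈ oppositeFactors (2 * N) | (2 * e + 1) * x.1 < x.2} := by
  classical
  rw [← card_recurrence_solutions, card_eq_sum_ones, sum_filter, Nat.cast_sum]
  refine sum_congr rfl fun r hr => ?_
  rw [coeff_of_recurrence (d := 2 * e + 1) (e := e)
    (fun r => pentagonalSeries (ZMod 2) * PowerSeries.mk fun n => (u r n : ZMod 2)) ?_ N r
    (mem_Icc.1 hr).1]
  · push_cast
    rfl
  · intro r hr
    have hmk : (PowerSeries.mk fun n => (u r n : ZMod 2)) = X ^ (r + e) *
        ((PowerSeries.mk fun n => (Fintype.card (Nat.Partition n) : ZMod 2)) +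
          PowerSeries.mk fun n => (u (r + (2 * e + 1)) n : ZMod 2)) := by
      ext n
      rw [coeff_X_pow_mul', coeff_mk]
      split_ifs with h
      · obtain ⟨m, rfl⟩ := Nat.exists_eq_add_of_le' h
        rw [Nat.add_sub_cancel, map_add, coeff_mk, coeff_mk, ← hadd r m, Nat.cast_add, add_assoc,
          CharTwo.add_self_eq_zero, add_zero]
      · rw [h0 r n hr (not_le.1 h), Nat.cast_zero]
    rw [hmk, mul_left_comm, mul_add, pentagonalSeries_mul_mk_card_partition]

theorem coeff_pentagonalSeries_mul_ospt (N : ℕ) :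
    coeff N (pentagonalSeries (ZMod 2) * PowerSeries.mk fun n => (ospt n : ZMod 2)) =
      #{x ∈ oppositeFactors (2 * N) | x.1 < x.2} +
        #{x ∈ oppositeFactors (2 * N) | 3 * x.1 < x.2} := by
  have hhole := coeff_pentagonalSeries_mul_of_recurrence (e := 0) holeCount
    (fun r n _ h => holeCount_eq_zero h) holeCount_add N
  have hrank := coeff_pentagonalSeries_mul_of_recurrence (e := 1) rankGE
    (fun r n hr h => rankGE_eq_zero hr (by omega)) rankGE_add N
  simp only [mul_zero, zero_add, one_mul] at hhole
  rw [← hhole, ← hrank, ← sum_add_distrib]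
  simp only [coeff_mul, coeff_mk]
  simp only [← sum_add_distrib, ← mul_add]
  rw [sum_comm]
  refine sum_congr rfl fun x hx => ?_
  rw [← mul_sum]
  congr 1
  have hxN : x.2 ≤ N := by
    rw [HasAntidiagonal.mem_antidiagonal] at hx
    omega
  rw [ospt_eq_sum, Int.cast_sum]
  -- The range of `r` may be extended from `x.2` to `N` since both counts vanish for `r > x.2`.
  refine (sum_congr rfl fun r _ => ?_).trans
    (sum_subset (Icc_subset_Icc_right hxN) fun r hr hr' => ?_)
  · push_cast
    rw [CharTwo.sub_eq_add]
  · rw [mem_Icc] at hr hr'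
    rw [holeCount_eq_zero (by omega), rankGE_eq_zero (by omega) (by omega)]
    simp

theorem ospt_eq_smallDivisorCount (N : ℕ) :
    (ospt N : ZMod 2) = smallDivisorCount (24 * N - 1) := by
  have key : pentagonalSeries (ZMod 2) * (PowerSeries.mk fun n => (ospt n : ZMod 2)) =
      pentagonalSeries (ZMod 2) *
        PowerSeries.mk fun n => (smallDivisorCount (24 * n - 1) : ZMod 2) := by
    ext M
    rw [coeff_pentagonalSeries_mul_ospt, coeff_pentagonalSeries_mul_smallDivisorCount]
    rcases Nat.eq_zero_or_pos M with rfl | hM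
    · have hempty : triples 0 = ∅ := by
        refine eq_empty_of_forall_notMem ?_
        rintro ⟨x, d, e⟩ ht
        rw [mem_triples] at ht
        have := Nat.mul_pos ht.2.1 (ht.2.1.trans ht.2.2.1)
        omega
      simp [hempty, oppositeFactors]
    · exact (card_triples hM).symm
  have hunit := (IsUnit.of_mul_eq_one _ (pentagonalSeries_mul_mk_card_partition (ZMod 2)))
  have h := congrArg (coeff N) (hunit.mul_left_cancel key)
  simpa only [coeff_mk] using h

end Ospt

theorem theorem1p4 (N : ℕ) (hN : 0 < N) :
    Odd (Ospt.ospt N) ↔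
      ∃ ℓ a m : ℕ, ℓ.Prime ∧ ℓ ≡ 23 [MOD 24] ∧ 0 < m ∧ Nat.Coprime ℓ m ∧
        24 * N - 1 = ℓ ^ (4 * a + 1) * m ^ 2 := by
  -- Positivity of `N` makes the truncated difference `24 * N - 1` congruent to 23 modulo 24.
  rw [← Ospt.odd_smallDivisorCount_iff (by omega), ← ZMod.natCast_eq_one_iff_odd,
    ← Ospt.ospt_eq_smallDivisorCount, ZMod.intCast_eq_one_iff_odd]
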